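/- Let $(X,d)$ be a complete metric space with a Borel measure $\mu$ that is doubling: $0<\mu(B)<\infty$ for every open ball $B$ of positive radius, and there is $C_D\ge 1$ with $\mu(2B)\le C_D\,\mu(B)$ for every such ball ($\lambda B$ denotes the ball with the same center and $\lambda$ times the radius). **Curves.** A curve is a continuous, rectifiable, non-constant map $\gamma:[a,b]\to X$ of a compact interval, $\ell(\gamma)$ is its length, $\int_\gamma\rho\,ds$ is the path integral in the arc-length parametrization, and for a Borel set $A$ we put $\ell(\gamma\cap A)=\mathcal H^1(\gamma([a,b])\cap A)$. **Semmes pencil.** $X$ supports a Semmes pencil of curves if there is $C>0$ such that for all $x\neq y$ in $X$ there are a family $\Gamma_{xy}$ of curves and a probability measure $\sigma_{xy}$ on $\Gamma_{xy}$ such that each $\gamma\in\Gamma_{xy}$ joins $x$ to $y$ and has $\ell(\gamma)\le C\,d(x,y)$, and such that for every Borel set $A\subset X$ the map $\gamma\mapsto \ell(\gamma\cap A)$ is $\sigma_{xy}$-measurable and $$\int_{\Gamma_{xy}}\ell(\gamma\cap A)\,d\sigma_{xy}(\gamma)\le C\int_{CB_{x,y}\cap A}\left(\frac{d(x,z)}{\mu(B(x,d(x,z)))}+\frac{d(y,z)}{\mu(B(y,d(y,z)))}\right)d\mu(z),$$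 where $CB_{x,y}=B(x,C\,d(x,y))\cup B(y,C\,d(x,y))$. **$BV_{AM}$-upper bounds.** The AM-modulus of a family $\Gamma$ of curves is $$AM(\Gamma)=\inf_{(\rho_i)}\ \liminf_{i\to\infty}\int_X\rho_i\,d\mu ,$$ the infimum being over all sequences of Borel functions $\rho_i:X\to[0,\infty]$ with $\liminf_{i\to\infty}\int_\gamma\rho_i\,ds\ge 1$ for every $\gamma\in\Gamma$. A sequence $(g_i)$ of non-negative Borel functions in $L^1(X)$ is a $BV_{AM}$-upper bound of $u:X\to\mathbb R$ if $\liminf_{i\to\infty}\int_X g_i\,d\mu<\infty$ and there is a family $\Gamma$ of curves with $AM(\Gamma)=0$ such that every curve $\gamma\notin\Gamma$, parametrized by arc length on $[0,\ell(\gamma)]$, satisfies $$|u(\gamma(t))-u(\gamma(s))|\le\liminf_{i\to\infty}\int_{\gamma|_{[s,t]}}g_i\,ds$$ for all $s<t$ in $[0,\ell(\gamma)]$ outside a Lebesgue null set depending on $\gamma$. **Proposition.** If $X$ supports a Semmes pencil of curves, then $X$ supports the AM-Poincaré inequality: there are constants $C>0$ and $\lambda\ge 1$ such that for every $\mu$-measurable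 $u:X\to\mathbb R$, every $BV_{AM}$-upper bound $(g_i)$ of $u$ and every ball $B\subset X$ of radius $r>0$, the function $u$ is integrable on $B$ and, with $u_B=\frac1{\mu(B)}\int_B u\,d\mu$, $$\frac1{\mu(B)}\int_B|u-u_B|\,d\mu\le C\,r\,\liminf_{i\to\infty}\frac1{\mu(\lambda B)}\int_{\lambda B}g_i\,d\mu .$$ -/

import Mathlib

open MeasureTheory Set Filter Metric
open scoped ENNReal Topology

noncomputable section

/-- A non-constant rectifiable curve `γ : [a, b] → X`, `[a, b]` a compact interval.
(Only the values of `toFun` on `[a, b]` matter.) -/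
structure RectCurve (X : Type*) [MetricSpace X] where
  a : ℝ
  b : ℝ
  le : a ≤ b
  toFun : ℝ → X
  continuousOn : ContinuousOn toFun (Icc a b)
  rectifiable : eVariationOn toFun (Icc a b) ≠ ∞
  nonconstant : ∃ s ∈ Icc a b, ∃ t ∈ Icc a b, toFun s ≠ toFun t

namespace RectCurve

variable {X : Type*} [MetricSpace X]

/-- The length of `γ`, i.e. its total variation. -/
def length (γ : RectCurve X) : ℝ≥0∞ := eVariationOn γ.toFun (Icc γ.a γ.b)

/-- The trajectory (image) of `γ`. -/
def trace (γ : RectCurve X) : Set X := γ.toFun '' Icc γ.a γ.b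

/-- The arc-length parametrization of `γ`; its domain is `[0, length γ]`. -/
def arc (γ : RectCurve X) : ℝ → X :=
  naturalParameterization γ.toFun (Icc γ.a γ.b) γ.a

/-- The path integral `∫_γ ρ ds` of a non-negative function, computed in the arc-length
parametrization. -/
def pathIntegral (γ : RectCurve X) (ρ : X → ℝ≥0∞) : ℝ≥0∞ :=
  ∫⁻ r in Icc 0 γ.length.toReal, ρ (γ.arc r)

/-- The path integral of `ρ` over the subcurve of `γ` between the arc-length parameters
`s` and `t`. -/
def subpathIntegral (γ : RectCurve X) (s t : ℝ) (ρ : X → ℝ≥0∞) : ℝ≥0∞ :=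
  ∫⁻ r in Icc s t, ρ (γ.arc r)

end RectCurve

section Definitions

variable {X : Type*} [MetricSpace X] [MeasurableSpace X]

/-- `μ` is a doubling measure; as usual balls have positive and finite measure. -/
def IsDoublingMeasure (μ : Measure X) : Prop :=
  (∀ (x : X) (r : ℝ), 0 < r → 0 < μ (ball x r) ∧ μ (ball x r) < ∞) ∧
  ∃ C : ℝ, 1 ≤ C ∧ ∀ (x : X) (r : ℝ), 0 < r →
    μ (ball x (2 * r)) ≤ ENNReal.ofReal C * μ (ball x r)

/-- The sequences `(ρ_i)` of non-negative Borel functions that are admissible for the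
AM-modulus of the curve family `Γ`. -/
def AMAdmissible (Γ : Set (RectCurve X)) : Set (ℕ → X → ℝ≥0∞) :=
  {ρ | (∀ i, Measurable (ρ i)) ∧
    ∀ γ ∈ Γ, 1 ≤ liminf (fun i => γ.pathIntegral (ρ i)) atTop}

/-- The approximate modulus `AM(Γ)` of a family of curves. -/
def AMModulus (μ : Measure X) (Γ : Set (RectCurve X)) : ℝ≥0∞ :=
  ⨅ ρ ∈ AMAdmissible Γ, liminf (fun i => ∫⁻ z, ρ i z ∂μ) atTop

/-- `(g_i)` is a `BV_AM`-upper bound of `u`: the `g_i` are non-negative Borel functions in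
`L¹(X)` with `liminf ∫ g_i < ∞`, and off a family of curves of zero AM-modulus every curve `γ`,
in its arc-length parametrization, has a Lebesgue null set `N` of parameters such that
`|u(γ(t)) - u(γ(s))| ≤ liminf ∫_{γ|[s,t]} g_i ds` for all parameters `s < t` off `N`. -/
def IsBVAMUpperBound (μ : Measure X) (u : X → ℝ) (g : ℕ → X → ℝ≥0∞) : Prop :=
  (∀ i, Measurable (g i) ∧ ∫⁻ z, g i z ∂μ < ∞) ∧
  (∃ Γ : Set (RectCurve X), AMModulus μ Γ = 0 ∧
    ∀ γ : RectCurve X, γ ∉ Γ →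
      ∃ N : Set ℝ, volume N = 0 ∧
        ∀ s ∈ Icc 0 γ.length.toReal \ N, ∀ t ∈ Icc 0 γ.length.toReal \ N, s < t →
          ENNReal.ofReal |u (γ.arc t) - u (γ.arc s)| ≤
            liminf (fun i => γ.subpathIntegral s t (g i)) atTop) ∧
  liminf (fun i => ∫⁻ z, g i z ∂μ) atTop < ∞

/-- `(X, d, μ)` supports an AM-Poincaré inequality. The inequality is between extended
non-negative numbers, so nothing is lost if an integral is infinite; that `u` is integrable on
the ball, so that its average there makes sense, is part of the assertion. -/
def SupportsAMPoincare (μ : Measure X) : Prop :=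
  ∃ C lam : ℝ, 0 < C ∧ 1 ≤ lam ∧
    ∀ (u : X → ℝ) (g : ℕ → X → ℝ≥0∞), AEMeasurable u μ → IsBVAMUpperBound μ u g →
      ∀ (x : X) (r : ℝ), 0 < r →
        IntegrableOn u (ball x r) μ ∧
        ⨍⁻ z in ball x r, ENNReal.ofReal |u z - ⨍ w in ball x r, u w ∂μ| ∂μ ≤
          ENNReal.ofReal (C * r) *
            liminf (fun i => ⨍⁻ z in ball x (lam * r), g i z ∂μ) atTop

/-- The Riesz kernel `R_{xy}(z) = d(x,z)/μ(B(x,d(x,z))) + d(y,z)/μ(B(y,d(y,z)))`.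
(A summand is `0` at its own pole.) -/
def rieszKernel (μ : Measure X) (x y z : X) : ℝ≥0∞ :=
  ENNReal.ofReal (dist x z) / μ (ball x (dist x z)) +
    ENNReal.ofReal (dist y z) / μ (ball y (dist y z))

/-- The set `C B_{x,y} = B(x, C d(x,y)) ∪ B(y, C d(x,y))`. -/
def twoBalls (C : ℝ) (x y : X) : Set X :=
  ball x (C * dist x y) ∪ ball y (C * dist x y)

/-- `(X, d, μ)` supports a Semmes pencil of curves. Here `ℓ(γ ∩ A)` is the one-dimensional
Hausdorff measure of the part of the trajectory of `γ` in `A`, and measurability with respect to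
`σ` is measurability with respect to the completion of `σ`. -/
def SupportsSemmesPencil [BorelSpace X] (μ : Measure X) : Prop :=
  ∃ C : ℝ, 0 < C ∧ ∀ x y : X, x ≠ y →
    ∃ (Γ : Set (RectCurve X)) (_ : MeasurableSpace Γ) (σ : Measure Γ),
      IsProbabilityMeasure σ ∧
      (∀ γ ∈ Γ, γ.toFun γ.a = x ∧ γ.toFun γ.b = y ∧
        γ.length ≤ ENNReal.ofReal (C * dist x y)) ∧
      ∀ A : Set X, MeasurableSet A →
        AEMeasurable (fun γ : Γ => Measure.hausdorffMeasure 1 (γ.1.trace ∩ A)) σ ∧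
        ∫⁻ γ : Γ, Measure.hausdorffMeasure 1 (γ.1.trace ∩ A) ∂σ ≤
          ENNReal.ofReal C * ∫⁻ z in twoBalls C x y ∩ A, rieszKernel μ x y z ∂μ

end Definitions

end

/-! The core is a pointwise estimate: for almost every pair `x`, `y` in the ball, `|u x - u y|` is
at most `2C` times the liminf of the integrals of `g i` against the Riesz kernel
(`IsPencil.ofReal_abs_sub_le`). Integrating it over `B × B` by Fatou and Tonelli, and using that one
pole of the kernel has integral `≲ δ` over a ball of radius `δ`, bounds the mean oscillation and
also yields integrability of `u`.

To get the estimate, the pencil inequality is extended from sets to Borel functions, so that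
averages over the pencil are controlled by the kernel. Three difficulties arise.

Multiplicity: the pencil controls `H^1` on traces, whereas path integrals count repetitions. Each
curve is replaced by an injective subcurve with the same endpoints (`RectCurve.exists_injOn_arc`),
whose path integrals are bounded by integrals over the original trace.

Endpoints: the upper bound holds only off a null set of parameters, so it says nothing at `x` and
`y` themselves. At points of approximate continuity, most curves of the pencil pass close to `x` and
`y` through points where `u` is almost `u x`, `u y`. By Chebyshev this needs the kernel integral
over the bad part of `B(x,δ)` to be `o(δ)`. The pole at `x` is harmless, but the pole at `y`
requires `μ(B(x,δ)) ≤ Mδ` along some sequence `δ → 0`. This finite lower density holds almost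
everywhere: the complementary set is `H^1`-null, hence invisible to curves, and a pencil issuing
from one of its density points would have too little mass to live on
(`DoublingWith.measure_compl_finiteLowerDensitySet`).

Exceptional curves: since `AM(Γ₀) = 0`, for almost every pair there are admissible sequences with
arbitrarily small kernel integrals, so `Γ₀` captures only a small part of the pencil
(`DoublingWith.exists_admissible_of_AMModulus_eq_zero`). -/

noncomputable section

/-! ### Continuity of the arc-length function of a rectifiable curve. -/

section Variation

variable {E : Type*} [PseudoEMetricSpace E]

/-- Truncating to `x ↦ f (min x t)` turns a moving endpoint into a pointwise convergent family of
maps on the fixed interval, and variation is lower semicontinuous under pointwise convergence. -/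
theorem eventually_lt_eVariationOn_Icc_left {f : ℝ → E} {a b : ℝ} (hf : ContinuousOn f (Icc a b))
    {t₀ : ℝ} (ht₀ : t₀ ∈ Icc a b) {v : ℝ≥0∞} (hv : v < eVariationOn f (Icc a t₀)) :
    ∀ᶠ t in 𝓝[Icc a b] t₀, v < eVariationOn f (Icc a t) := by
  have h1 : v < eVariationOn (fun x => f (min x t₀)) (Icc a b) := by
    refine hv.trans_le ?_
    refine le_trans (le_of_eq ?_) (eVariationOn.mono _ (Icc_subset_Icc_right ht₀.2))
    exact eVariationOn.congr fun x hx => by simp [hx.2]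
  have h2 := eVariationOn.lowerSemicontinuous_aux (F := fun t x => f (min x t))
    (p := 𝓝[Icc a b] t₀) (f := fun x => f (min x t₀)) (s := Icc a b) ?_ h1
  · filter_upwards [h2, self_mem_nhdsWithin] with t ht hts
    refine ht.trans_le (eVariationOn.comp_le_of_monotoneOn f (fun x => min x t) ?_ ?_)
    · intro x _ y _ hxy; exact min_le_min_right _ hxy
    · intro x hx; exact ⟨le_min hx.1 hts.1, min_le_right _ _⟩
  · intro x hx
    have hm : min x t₀ ∈ Icc a b := ⟨le_min hx.1 ht₀.1, (min_le_left _ _).trans hx.2⟩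
    refine (hf _ hm).tendsto.comp (tendsto_nhdsWithin_iff.2 ⟨?_, ?_⟩)
    · exact (tendsto_const_nhds.min (tendsto_id.mono_left nhdsWithin_le_nhds))
    · filter_upwards [self_mem_nhdsWithin] with t ht
      exact ⟨le_min hx.1 ht.1, (min_le_left _ _).trans hx.2⟩

theorem eventually_lt_eVariationOn_Icc_right {f : ℝ → E} {a b : ℝ} (hf : ContinuousOn f (Icc a b))
    {t₀ : ℝ} (ht₀ : t₀ ∈ Icc a b) {v : ℝ≥0∞} (hv : v < eVariationOn f (Icc t₀ b)) :
    ∀ᶠ t in 𝓝[Icc a b] t₀, v < eVariationOn f (Icc t b) := by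
  have h1 : v < eVariationOn (fun x => f (max x t₀)) (Icc a b) := by
    refine hv.trans_le ?_
    refine le_trans (le_of_eq ?_) (eVariationOn.mono _ (Icc_subset_Icc_left ht₀.1))
    exact eVariationOn.congr fun x hx => by simp [hx.1]
  have h2 := eVariationOn.lowerSemicontinuous_aux (F := fun t x => f (max x t))
    (p := 𝓝[Icc a b] t₀) (f := fun x => f (max x t₀)) (s := Icc a b) ?_ h1
  · filter_upwards [h2, self_mem_nhdsWithin] with t ht hts
    refine ht.trans_le (eVariationOn.comp_le_of_monotoneOn f (fun x => max x t) ?_ ?_)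
    · intro x _ y _ hxy; exact max_le_max_right _ hxy
    · intro x hx; exact ⟨le_max_right _ _, max_le hx.2 hts.2⟩
  · intro x hx
    have hm : max x t₀ ∈ Icc a b := ⟨hx.1.trans (le_max_left _ _), max_le hx.2 ht₀.2⟩
    refine (hf _ hm).tendsto.comp (tendsto_nhdsWithin_iff.2 ⟨?_, ?_⟩)
    · exact (tendsto_const_nhds.max (tendsto_id.mono_left nhdsWithin_le_nhds))
    · filter_upwards [self_mem_nhdsWithin] with t ht
      exact ⟨hx.1.trans (le_max_left _ _), max_le hx.2 ht.2⟩

theorem eVariationOn_Icc_add_Icc (f : ℝ → E) {a t b : ℝ} (h₁ : a ≤ t) (h₂ : t ≤ b) :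
    eVariationOn f (Icc a t) + eVariationOn f (Icc t b) = eVariationOn f (Icc a b) := by
  simpa using eVariationOn.Icc_add_Icc f (s := univ) h₁ h₂ (mem_univ t)

/-- The variations to the left and to the right of `t` are both lower semicontinuous and have a
constant finite sum, so each is also upper semicontinuous. -/
theorem continuousOn_toReal_eVariationOn_Icc {f : ℝ → E} {a b : ℝ} (hf : ContinuousOn f (Icc a b))
    (hb : eVariationOn f (Icc a b) ≠ ∞) :
    ContinuousOn (fun t => (eVariationOn f (Icc a t)).toReal) (Icc a b) := by
  have fl : ∀ t ∈ Icc a b, eVariationOn f (Icc a t) ≠ ∞ := fun t ht =>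
    ne_top_of_le_ne_top hb (eVariationOn.mono _ (Icc_subset_Icc_right ht.2))
  have fr : ∀ t ∈ Icc a b, eVariationOn f (Icc t b) ≠ ∞ := fun t ht =>
    ne_top_of_le_ne_top hb (eVariationOn.mono _ (Icc_subset_Icc_left ht.1))
  have hsum : ∀ t ∈ Icc a b, (eVariationOn f (Icc a t)).toReal + (eVariationOn f (Icc t b)).toReal
      = (eVariationOn f (Icc a b)).toReal := fun t ht => by
    rw [← ENNReal.toReal_add (fl t ht) (fr t ht), eVariationOn_Icc_add_Icc f ht.1 ht.2]
  rw [continuousOn_iff_lower_upperSemicontinuousOn]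
  constructor
  · intro t₀ ht₀ y hy
    rcases lt_or_ge y 0 with h0 | h0
    · exact Eventually.of_forall fun t => h0.trans_le ENNReal.toReal_nonneg
    have := eventually_lt_eVariationOn_Icc_left hf ht₀ (v := ENNReal.ofReal y)
      ((ENNReal.ofReal_lt_iff_lt_toReal h0 (fl _ ht₀)).2 hy)
    filter_upwards [this, self_mem_nhdsWithin] with t ht hts
    exact (ENNReal.ofReal_lt_iff_lt_toReal h0 (fl _ hts)).1 ht
  · intro t₀ ht₀ y hy
    set z := (eVariationOn f (Icc a b)).toReal - y with hz
    have hzw : z < (eVariationOn f (Icc t₀ b)).toReal := by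
      have := hsum t₀ ht₀
      simp only at hy
      linarith
    rcases lt_or_ge z 0 with h0 | h0
    · filter_upwards [self_mem_nhdsWithin] with t hts
      have h1 := hsum t hts
      have : 0 ≤ (eVariationOn f (Icc t b)).toReal := ENNReal.toReal_nonneg
      linarith
    have := eventually_lt_eVariationOn_Icc_right hf ht₀ (v := ENNReal.ofReal z)
      ((ENNReal.ofReal_lt_iff_lt_toReal h0 (fr _ ht₀)).2 hzw)
    filter_upwards [this, self_mem_nhdsWithin] with t ht hts
    have h1 := hsum t hts
    have h2 := (ENNReal.ofReal_lt_iff_lt_toReal h0 (fr _ hts)).1 ht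
    linarith

end Variation

/-! ### The arc-length parametrization. -/

namespace RectCurve

variable {X : Type*} [MetricSpace X] (γ : RectCurve X)

theorem left_mem : γ.a ∈ Icc γ.a γ.b := ⟨le_rfl, γ.le⟩

theorem right_mem : γ.b ∈ Icc γ.a γ.b := ⟨γ.le, le_rfl⟩

theorem locallyBounded : LocallyBoundedVariationOn γ.toFun (Icc γ.a γ.b) :=
  BoundedVariationOn.locallyBoundedVariationOn γ.rectifiable

theorem variation_eq {t : ℝ} (ht : t ∈ Icc γ.a γ.b) :
    variationOnFromTo γ.toFun (Icc γ.a γ.b) γ.a t = (eVariationOn γ.toFun (Icc γ.a t)).toReal := by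
  rw [variationOnFromTo.eq_of_le _ _ ht.1, inter_eq_right.2 (Icc_subset_Icc_right ht.2)]

/-- Surjectivity onto `[0, ℓ]` is what continuity of arc length is for: it makes the unit-speed
property of `arc` available on the whole interval. -/
theorem variation_image :
    variationOnFromTo γ.toFun (Icc γ.a γ.b) γ.a '' Icc γ.a γ.b = Icc 0 γ.length.toReal := by
  rw [image_congr fun t ht => γ.variation_eq ht]
  have h0 : (eVariationOn γ.toFun (Icc γ.a γ.a)).toReal = 0 := by
    simp [eVariationOn.subsingleton]
  apply Subset.antisymm
  · rintro _ ⟨t, ht, rfl⟩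
    exact ⟨ENNReal.toReal_nonneg, ENNReal.toReal_mono γ.rectifiable
      (eVariationOn.mono _ (Icc_subset_Icc_right ht.2))⟩
  · have := intermediate_value_Icc γ.le
      (continuousOn_toReal_eVariationOn_Icc γ.continuousOn γ.rectifiable)
    simpa only [h0] using! this

theorem arc_variation {t : ℝ} (ht : t ∈ Icc γ.a γ.b) :
    γ.arc (variationOnFromTo γ.toFun (Icc γ.a γ.b) γ.a t) = γ.toFun t :=
  edist_eq_zero.1 (edist_naturalParameterization_eq_zero γ.locallyBounded γ.left_mem ht)

theorem arc_zero : γ.arc 0 = γ.toFun γ.a := by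
  have := γ.arc_variation γ.left_mem
  rwa [variationOnFromTo.self] at this

theorem arc_length : γ.arc γ.length.toReal = γ.toFun γ.b := by
  have := γ.arc_variation γ.right_mem
  rwa [γ.variation_eq γ.right_mem] at this

theorem arc_mem_trace {r : ℝ} (hr : r ∈ Icc 0 γ.length.toReal) : γ.arc r ∈ γ.trace := by
  rw [← γ.variation_image] at hr
  obtain ⟨t, ht, rfl⟩ := hr
  rw [γ.arc_variation ht]
  exact mem_image_of_mem _ ht

theorem eVariationOn_arc {s t : ℝ} (hs : 0 ≤ s) (hst : s ≤ t) (ht : t ≤ γ.length.toReal) :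
    eVariationOn γ.arc (Icc s t) = ENNReal.ofReal (t - s) := by
  have h := has_unit_speed_naturalParameterization γ.toFun γ.locallyBounded γ.left_mem
  rw [γ.variation_image] at h
  have h' := h (x := s) ⟨hs, hst.trans ht⟩ (y := t) ⟨hs.trans hst, ht⟩
  rw [inter_eq_right.2 (Icc_subset_Icc hs ht)] at h'
  simpa using! h'

theorem lipschitzOnWith_arc : LipschitzOnWith 1 γ.arc (Icc 0 γ.length.toReal) := by
  have key : ∀ s ∈ Icc 0 γ.length.toReal, ∀ t ∈ Icc 0 γ.length.toReal, s ≤ t →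
      edist (γ.arc s) (γ.arc t) ≤ edist s t := by
    intro s hs t ht hst
    refine (eVariationOn.edist_le γ.arc (s := Icc s t) ⟨le_rfl, hst⟩ ⟨hst, le_rfl⟩).trans ?_
    rw [γ.eVariationOn_arc hs.1 hst ht.2, edist_dist, Real.dist_eq, abs_sub_comm]
    exact ENNReal.ofReal_le_ofReal (le_abs_self _)
  intro s hs t ht
  rw [ENNReal.coe_one, one_mul]
  rcases le_total s t with h | h
  · exact key s hs t ht h
  · rw [edist_comm, edist_comm s]; exact key t ht s hs h

theorem isCompact_trace : IsCompact γ.trace := isCompact_Icc.image_of_continuousOn γ.continuousOn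

end RectCurve

/-! ### Extraction of an injective subcurve by minimizing travel time inside the trace. -/

section InjectiveSubcurve

variable {X : Type*} [MetricSpace X]

/-- `IsReach K x y L f`: the map `f` is `1`-Lipschitz into `K`, starts at `x` and is at `y`
at time `L`. -/
def IsReach (K : Set X) (x y : X) (L : ℝ) (f : ℝ → X) : Prop :=
  (∀ t, f t ∈ K) ∧ (∀ s t, dist (f s) (f t) ≤ |s - t|) ∧ f 0 = x ∧ ∀ t, dist (f t) y ≤ |t - L|

theorem isReach_of_lipschitzOnWith {K : Set X} {x y : X} {L : ℝ} (hL : 0 ≤ L) {c : ℝ → X}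
    (hc : ∀ s ∈ Icc 0 L, ∀ t ∈ Icc 0 L, dist (c s) (c t) ≤ |s - t|)
    (hK : ∀ t ∈ Icc 0 L, c t ∈ K) (h0 : c 0 = x) (h1 : c L = y) :
    IsReach K x y L (fun t => c (projIcc 0 L hL t)) := by
  have hl : ∀ s t, dist (c (projIcc 0 L hL s)) (c (projIcc 0 L hL t)) ≤ |s - t| := fun s t => by
    refine (hc _ (projIcc 0 L hL s).2 _ (projIcc 0 L hL t).2).trans ?_
    exact abs_projIcc_sub_projIcc hL
  refine ⟨fun t => hK _ (projIcc 0 L hL t).2, hl, ?_, fun t => ?_⟩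
  · simp [projIcc_left, h0]
  · have := hl t L
    rwa [projIcc_right, h1] at this

/-- Tychonoff compactness for pairs (time, map) in the topology of pointwise convergence. There `(L,
f) ↦ f L` need not be continuous, so arrival at `y` is encoded by the inequalities `dist (f t) y ≤
|t - L|`, each of which is closed. -/
theorem exists_isReach_minimal {K : Set X} (hK : IsCompact K) {x y : X} {M : ℝ} (hM : 0 ≤ M)
    {f₀ : ℝ → X} (h₀ : IsReach K x y M f₀) :
    ∃ L f, 0 ≤ L ∧ L ≤ M ∧ IsReach K x y L f ∧ ∀ L' f', 0 ≤ L' → IsReach K x y L' f' → L ≤ L' := by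
  set T : Set (ℝ × (ℝ → X)) := {p | p.1 ∈ Icc 0 M ∧ IsReach K x y p.1 p.2} with hT
  have hTc : IsCompact T := by
    have hc : IsCompact (Icc (0 : ℝ) M ×ˢ (univ.pi fun _ : ℝ => K)) :=
      isCompact_Icc.prod (isCompact_univ_pi fun _ => hK)
    have hTeq : T = (Icc (0 : ℝ) M ×ˢ (univ.pi fun _ : ℝ => K)) ∩
        ((⋂ s : ℝ, ⋂ t : ℝ, {p : ℝ × (ℝ → X) | dist (p.2 s) (p.2 t) ≤ |s - t|}) ∩
        ({p : ℝ × (ℝ → X) | p.2 0 = x} ∩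
          ⋂ t : ℝ, {p : ℝ × (ℝ → X) | dist (p.2 t) y ≤ |t - p.1|})) := by
      ext p
      simp only [hT, IsReach, mem_ofPred_eq, mem_inter_iff, mem_prod, mem_univ_pi, mem_iInter]
      tauto
    rw [hTeq]
    refine hc.inter_right ((isClosed_iInter fun s => isClosed_iInter fun t => ?_).inter
      (IsClosed.inter ?_ (isClosed_iInter fun t => ?_)))
    · exact isClosed_le (by fun_prop) continuous_const
    · exact isClosed_eq (by fun_prop) continuous_const
    · exact isClosed_le (by fun_prop) (by fun_prop)
  obtain ⟨⟨L, f⟩, hp, hmin⟩ := hTc.exists_isMinOn ⟨(M, f₀), ⟨hM, le_rfl⟩, h₀⟩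
    (continuous_fst.continuousOn)
  refine ⟨L, f, hp.1.1, hp.1.2, hp.2, fun L' f' h0 h' => ?_⟩
  rcases le_total L' M with h | h
  · exact hmin (a := (L', f')) ⟨⟨h0, h⟩, h'⟩
  · exact hp.1.2.trans h

theorem cut_lipschitz {c : ℝ → X} {ℓ s t : ℝ}
    (hc : ∀ p ∈ Icc 0 ℓ, ∀ q ∈ Icc 0 ℓ, dist (c p) (c q) ≤ |p - q|)
    (hs : 0 ≤ s) (hst : s < t) (ht : t ≤ ℓ) (heq : c s = c t) :
    ∀ p ∈ Icc 0 (ℓ - (t - s)), ∀ q ∈ Icc 0 (ℓ - (t - s)),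
      dist (if p ≤ s then c p else c (p + (t - s))) (if q ≤ s then c q else c (q + (t - s)))
        ≤ |p - q| := by
  have key : ∀ p ∈ Icc 0 (ℓ - (t - s)), ∀ q ∈ Icc 0 (ℓ - (t - s)), p ≤ s → s < q →
      dist (c p) (c (q + (t - s))) ≤ |p - q| := by
    intro p hp q hq hps hsq
    have h1 := hc p ⟨hp.1, by linarith⟩ s ⟨hs, by linarith⟩
    have h2 := hc t ⟨by linarith, ht⟩ (q + (t - s)) ⟨by linarith, by linarith [hq.2]⟩
    have h3 := dist_triangle (c p) (c s) (c (q + (t - s)))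
    rw [heq] at h3 h1
    rw [abs_of_nonpos (by linarith)] at h1 h2 ⊢
    linarith
  intro p hp q hq
  have hp' := hp.2
  have hq' := hq.2
  split_ifs with h1 h2 h2
  · exact hc p ⟨hp.1, by linarith⟩ q ⟨hq.1, by linarith⟩
  · exact key p hp q hq h1 (not_le.1 h2)
  · rw [dist_comm, abs_sub_comm]; exact key q hq p hp h2 (not_le.1 h1)
  · have := hc (p + (t - s)) ⟨by linarith [hp.1], by linarith⟩ (q + (t - s))
      ⟨by linarith [hq.1], by linarith⟩
    simpa using this

namespace RectCurve

theorem dist_arc_le (γ : RectCurve X) :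
    ∀ s ∈ Icc 0 γ.length.toReal, ∀ t ∈ Icc 0 γ.length.toReal,
      dist (γ.arc s) (γ.arc t) ≤ |s - t| := fun s hs t ht => by
  have := γ.lipschitzOnWith_arc.dist_le_mul s hs t ht
  simpa [Real.dist_eq] using this

/-- A rectifiable curve with distinct endpoints contains one with the same endpoints
whose arc-length parametrization is injective. -/
theorem exists_injOn_arc (γ : RectCurve X) (hne : γ.toFun γ.a ≠ γ.toFun γ.b) :
    ∃ γ' : RectCurve X, γ'.trace ⊆ γ.trace ∧ γ'.toFun γ'.a = γ.toFun γ.a ∧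
      γ'.toFun γ'.b = γ.toFun γ.b ∧ InjOn γ'.arc (Icc 0 γ'.length.toReal) := by
  have hM : 0 ≤ γ.length.toReal := ENNReal.toReal_nonneg
  obtain ⟨L, f, hL0, -, ⟨hfK, hfl, hf0, hfL⟩, hmin⟩ := exists_isReach_minimal γ.isCompact_trace hM
    (isReach_of_lipschitzOnWith hM γ.dist_arc_le (fun t ht => γ.arc_mem_trace ht)
      γ.arc_zero γ.arc_length)
  have hfL' : f L = γ.toFun γ.b := by
    have := hfL L
    simpa using this
  have hfLip : LipschitzWith 1 f := LipschitzWith.of_dist_le_mul fun s t => by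
    simpa [Real.dist_eq] using hfl s t
  have hlen : eVariationOn f (Icc 0 L) ≤ ENNReal.ofReal L := by
    have := hfLip.lipschitzOnWith.comp_eVariationOn_le (f := f) (g := fun t : ℝ => t)
      (s := Icc 0 L) (mapsTo_univ _ _)
    refine this.trans ?_
    have h2 := eVariationOn_id_Icc 0 L
    simp only [ENNReal.coe_one, one_mul]
    exact h2.le.trans (by simp)
  let γ' : RectCurve X :=
    { a := 0, b := L, le := hL0, toFun := f
      continuousOn := hfLip.continuous.continuousOn
      rectifiable := ne_top_of_le_ne_top ENNReal.ofReal_ne_top hlen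
      nonconstant := ⟨0, ⟨le_rfl, hL0⟩, L, ⟨hL0, le_rfl⟩, by rw [hf0, hfL']; exact hne⟩ }
  have htr : γ'.trace ⊆ γ.trace := by
    rintro _ ⟨t, -, rfl⟩
    exact hfK t
  have hℓ : γ'.length.toReal ≤ L := by
    have := ENNReal.toReal_mono ENNReal.ofReal_ne_top hlen
    rwa [ENNReal.toReal_ofReal hL0] at this
  refine ⟨γ', htr, hf0, hfL', ?_⟩
  -- If the minimizer returned to a point, excising the loop would reach `y` in time at most `L - (t
  -- - s)`, contradicting minimality.
  have key : ∀ s ∈ Icc 0 γ'.length.toReal, ∀ t ∈ Icc 0 γ'.length.toReal, s < t →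
      γ'.arc s ≠ γ'.arc t := by
    intro s hs t ht hst heq
    set c : ℝ → X := fun p => if p ≤ s then γ'.arc p else γ'.arc (p + (t - s)) with hcdef
    have hnn : 0 ≤ γ'.length.toReal - (t - s) := by linarith [ht.2, hs.1]
    have hr := isReach_of_lipschitzOnWith (K := γ.trace) (x := γ.toFun γ.a) (y := γ.toFun γ.b)
      hnn (c := c) (cut_lipschitz γ'.dist_arc_le hs.1 hst ht.2 heq) ?_ ?_ ?_
    · have := hmin _ _ hnn hr
      linarith
    · intro p hp
      simp only [hcdef]
      split_ifs with h
      · exact htr (γ'.arc_mem_trace ⟨hp.1, by linarith [hs.2]⟩)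
      · exact htr (γ'.arc_mem_trace ⟨by linarith [hp.1], by linarith [hp.2]⟩)
    · simp only [hcdef, if_pos hs.1]
      rw [γ'.arc_zero]; exact hf0
    · have hend : γ'.arc γ'.length.toReal = γ.toFun γ.b := γ'.arc_length.trans hfL'
      simp only [hcdef]
      split_ifs with h
      · have h1 : γ'.length.toReal - (t - s) = s := by linarith [ht.2]
        have h2 : γ'.length.toReal = t := by linarith
        rw [h1, heq, ← h2]; exact hend
      · rw [sub_add_cancel]; exact hend
  intro s hs t ht heq
  rcases lt_trichotomy s t with h | h | h
  · exact absurd heq (key s hs t ht h)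
  · exact h
  · exact absurd heq.symm (key t ht s hs h)

end RectCurve

end InjectiveSubcurve

/-! ### Path integrals along injective curves and Hausdorff measure on traces. -/

section HausdorffMeasure

variable {X : Type*} [MetricSpace X] [MeasurableSpace X] [BorelSpace X]

open Measure

/-- A continuous image of an interval, without its starting point, has one-dimensional measure
at least the distance of the endpoints. -/
theorem edist_le_hausdorffMeasure_image_Ioc {c : ℝ → X} {s t : ℝ} (hst : s ≤ t)
    (hc : ContinuousOn c (Icc s t)) : edist (c s) (c t) ≤ hausdorffMeasure 1 (c '' Ioc s t) := by
  -- The distance to `c s` is 1-Lipschitz and takes every value in `(0, d]` on the image, by the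
  -- intermediate value theorem.
  have h1 : Ioc 0 (dist (c s) (c t)) ⊆ (fun z => dist (c s) z) '' (c '' Ioc s t) := by
    intro v hv
    have hcont : ContinuousOn (fun r => dist (c s) (c r)) (Icc s t) :=
      (continuous_const.dist continuous_id).comp_continuousOn hc
    obtain ⟨r, hr, hrv⟩ := intermediate_value_Icc hst hcont
      (show v ∈ Icc (dist (c s) (c s)) (dist (c s) (c t)) by simpa using ⟨hv.1.le, hv.2⟩)
    refine ⟨c r, ⟨r, ⟨lt_of_le_of_ne hr.1 ?_, hr.2⟩, rfl⟩, hrv⟩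
    rintro rfl
    simp only [dist_self] at hrv
    exact hv.1.ne hrv
  have h2 := (LipschitzWith.dist_right (c s)).hausdorffMeasure_image_le zero_le_one (c '' Ioc s t)
  have h3 := measure_mono (μ := (volume : Measure ℝ)) h1
  rw [hausdorffMeasure_real] at h2
  rw [Real.volume_Ioc, sub_zero] at h3
  rw [edist_dist]
  simpa using h3.trans h2

/-- The trace of a curve has one-dimensional measure at least its variation if the curve is
injective. -/
theorem eVariationOn_le_hausdorffMeasure_image {c : ℝ → X} {a b : ℝ}
    (hc : ContinuousOn c (Icc a b)) (hi : InjOn c (Icc a b)) :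
    eVariationOn c (Icc a b) ≤ hausdorffMeasure 1 (c '' Icc a b) := by
  refine iSup_le ?_
  rintro ⟨n, u, hu, hus⟩
  have hsub : ∀ i, Ioc (u i) (u (i + 1)) ⊆ Icc a b := fun i r hr =>
    ⟨(hus i).1.trans hr.1.le, hr.2.trans (hus (i + 1)).2⟩
  have hsub' : ∀ i, Icc (u i) (u (i + 1)) ⊆ Icc a b := fun i =>
    Icc_subset_Icc (hus i).1 (hus (i + 1)).2
  -- Half-open pieces make the images disjoint; by injectivity each is a compact set minus one
  -- point.
  have hmeas : ∀ i, MeasurableSet (c '' Ioc (u i) (u (i + 1))) := by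
    intro i
    have : c '' Ioc (u i) (u (i + 1)) = c '' Icc (u i) (u (i + 1)) \ {c (u i)} := by
      apply Subset.antisymm
      · rintro _ ⟨r, hr, rfl⟩
        refine ⟨⟨r, ⟨hr.1.le, hr.2⟩, rfl⟩, fun h => ?_⟩
        exact hr.1.ne (hi (hsub i hr) (hus i) h).symm
      · rintro _ ⟨⟨r, hr, rfl⟩, h⟩
        exact ⟨r, ⟨lt_of_le_of_ne hr.1 (by rintro rfl; exact h rfl), hr.2⟩, rfl⟩
    rw [this]
    exact (isCompact_Icc.image_of_continuousOn (hc.mono (hsub' i))).measurableSet.diff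
      (measurableSet_singleton _)
  have hdis : Pairwise (Function.onFun Disjoint fun i => c '' Ioc (u i) (u (i + 1))) := by
    intro i j hij
    refine (hi.image_inter (hsub i) (hsub j)).symm ▸ ?_ |> disjoint_iff_inter_eq_empty.2
    have := (hu.pairwise_disjoint_on_Ioc_succ) hij
    simp only [Function.onFun, Order.succ_eq_add_one] at this
    rw [disjoint_iff_inter_eq_empty.1 this, image_empty]
  calc ∑ i ∈ Finset.range n, edist (c (u (i + 1))) (c (u i))
      ≤ ∑ i ∈ Finset.range n, hausdorffMeasure 1 (c '' Ioc (u i) (u (i + 1))) := by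
        refine Finset.sum_le_sum fun i _ => ?_
        rw [edist_comm]
        exact edist_le_hausdorffMeasure_image_Ioc (hu (Nat.le_succ i)) (hc.mono (hsub' i))
    _ = hausdorffMeasure 1 (⋃ i ∈ Finset.range n, c '' Ioc (u i) (u (i + 1))) := by
        rw [measure_biUnion_finset (fun i _ j _ h => hdis h) (fun i _ => hmeas i)]
    _ ≤ hausdorffMeasure 1 (c '' Icc a b) :=
        measure_mono (iUnion₂_subset fun i _ => image_mono (hsub i))

namespace RectCurve

variable (γ : RectCurve X)

theorem measurableSet_preimage_arc {A : Set X} (hA : MeasurableSet A) :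
    MeasurableSet (Icc 0 γ.length.toReal ∩ γ.arc ⁻¹' A) := by
  have h := (continuousOn_iff_continuous_domRestrict.1 γ.lipschitzOnWith_arc.continuousOn).measurable
  have := measurableSet_Icc.subtype_image (h hA)
  convert this using 1
  ext r
  simp [and_comm]

/-- By injectivity the whole image has measure at least `ℓ`, while the part outside `A` has at most
the length of its parameter set because `arc` is 1-Lipschitz. Subtracting leaves the bound inside
`A`. -/
theorem volume_preimage_arc_le (hi : InjOn γ.arc (Icc 0 γ.length.toReal)) {A : Set X}
    (hA : MeasurableSet A) :
    volume (Icc 0 γ.length.toReal ∩ γ.arc ⁻¹' A) ≤ hausdorffMeasure 1 (γ.trace ∩ A) := by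
  set I := Icc 0 γ.length.toReal with hI
  have h1 : volume I ≤ hausdorffMeasure 1 (γ.arc '' I) := by
    refine le_trans (le_of_eq ?_)
      (eVariationOn_le_hausdorffMeasure_image γ.lipschitzOnWith_arc.continuousOn hi)
    rw [γ.eVariationOn_arc le_rfl ENNReal.toReal_nonneg le_rfl, Real.volume_Icc]
  have h2 : hausdorffMeasure 1 (γ.arc '' (I \ γ.arc ⁻¹' A)) ≤ volume (I \ γ.arc ⁻¹' A) := by
    have := (γ.lipschitzOnWith_arc.mono
      (sdiff_subset : I \ γ.arc ⁻¹' A ⊆ I)).hausdorffMeasure_image_le zero_le_one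
    rw [hausdorffMeasure_real] at this
    simpa using this
  have h3 : γ.arc '' I ⊆ (γ.trace ∩ A) ∪ γ.arc '' (I \ γ.arc ⁻¹' A) := by
    rintro _ ⟨r, hr, rfl⟩
    by_cases h : γ.arc r ∈ A
    · exact Or.inl ⟨γ.arc_mem_trace hr, h⟩
    · exact Or.inr ⟨r, ⟨hr, h⟩, rfl⟩
  have h4 : volume (I ∩ γ.arc ⁻¹' A) + volume (I \ γ.arc ⁻¹' A) = volume I := by
    rw [← sdiff_inter_self_eq_sdiff, inter_comm]
    have := measure_inter_add_sdiff (μ := volume) I (γ.measurableSet_preimage_arc hA)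
    rwa [← inter_assoc, inter_self, inter_comm] at this
  have hfin : volume (I \ γ.arc ⁻¹' A) ≠ ∞ :=
    ne_top_of_le_ne_top measure_Icc_lt_top.ne (measure_mono (sdiff_subset : _ ⊆ I))
  rw [← ENNReal.add_le_add_iff_right hfin, h4]
  calc volume I ≤ _ := h1
    _ ≤ _ := measure_mono h3
    _ ≤ _ := measure_union_le _ _
    _ ≤ _ := by gcongr

theorem pathIntegral_le_lintegral_trace (hi : InjOn γ.arc (Icc 0 γ.length.toReal))
    {ρ : X → ℝ≥0∞} (hρ : Measurable ρ) :
    γ.pathIntegral ρ ≤ ∫⁻ z in γ.trace, ρ z ∂hausdorffMeasure 1 := by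
  have hae : AEMeasurable γ.arc (volume.restrict (Icc 0 γ.length.toReal)) :=
    γ.lipschitzOnWith_arc.continuousOn.aemeasurable measurableSet_Icc
  rw [pathIntegral, ← lintegral_map' hρ.aemeasurable hae]
  refine lintegral_mono' (Measure.le_iff.2 fun A hA => ?_) le_rfl
  rw [Measure.map_apply_of_aemeasurable hae hA, Measure.restrict_apply hA,
    Measure.restrict_apply' measurableSet_Icc, inter_comm, inter_comm A]
  exact γ.volume_preimage_arc_le hi hA

theorem edist_le_hausdorffMeasure_trace :
    edist (γ.toFun γ.a) (γ.toFun γ.b) ≤ hausdorffMeasure 1 γ.trace :=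
  (edist_le_hausdorffMeasure_image_Ioc γ.le γ.continuousOn).trans
    (measure_mono (image_mono Ioc_subset_Icc_self))

omit [MeasurableSpace X] [BorelSpace X] in
theorem dist_le_length : ENNReal.ofReal (dist (γ.toFun γ.a) (γ.toFun γ.b)) ≤ γ.length := by
  rw [← edist_dist]
  exact eVariationOn.edist_le _ γ.left_mem γ.right_mem

end RectCurve

end HausdorffMeasure

end

/-! ### Doubling measures: measurability, Riesz pole estimates and approximate continuity. -/

noncomputable section

variable {X : Type*} [MetricSpace X] [MeasurableSpace X]

/-- Balls have positive finite measure and `μ` is doubling with constant `D`. -/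
structure DoublingWith (μ : Measure X) (D : ℝ≥0∞) : Prop where
  one_le : 1 ≤ D
  ne_top : D ≠ ∞
  pos : ∀ (x : X) (r : ℝ), 0 < r → 0 < μ (ball x r)
  fin : ∀ (x : X) (r : ℝ), μ (ball x r) ≠ ∞
  dbl : ∀ (x : X) (r : ℝ), 0 < r → μ (ball x (2 * r)) ≤ D * μ (ball x r)

theorem IsDoublingMeasure.exists_doublingWith {μ : Measure X} (h : IsDoublingMeasure μ) :
    ∃ D, DoublingWith μ D := by
  obtain ⟨h1, C, hC, h2⟩ := h
  refine ⟨ENNReal.ofReal C, by simpa using hC, ENNReal.ofReal_ne_top, fun x r hr => (h1 x r hr).1,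
    fun x r => ?_, h2⟩
  rcases le_or_gt r 0 with hr | hr
  · simp [ball_eq_empty.2 hr]
  · exact (h1 x r hr).2.ne

/-- One summand of the Riesz kernel. -/
def rieszPole (μ : Measure X) (x z : X) : ℝ≥0∞ :=
  ENNReal.ofReal (dist x z) / μ (ball x (dist x z))

theorem rieszKernel_eq (μ : Measure X) (x y z : X) :
    rieszKernel μ x y z = rieszPole μ x z + rieszPole μ y z := rfl

namespace DoublingWith

variable {μ : Measure X} {D : ℝ≥0∞} (h : DoublingWith μ D)
include h

theorem D_ne_zero : D ≠ 0 := (zero_lt_one.trans_le h.one_le).ne'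

theorem measure_pow (x : X) {r : ℝ} (hr : 0 < r) (n : ℕ) :
    μ (ball x (2 ^ n * r)) ≤ D ^ n * μ (ball x r) := by
  induction n with
  | zero => simp
  | succ n ih =>
    calc μ (ball x (2 ^ (n + 1) * r)) = μ (ball x (2 * (2 ^ n * r))) := by ring_nf
      _ ≤ D * μ (ball x (2 ^ n * r)) := h.dbl x _ (by positivity)
      _ ≤ D * (D ^ n * μ (ball x r)) := by gcongr
      _ = D ^ (n + 1) * μ (ball x r) := by ring

theorem sigmaFinite : SigmaFinite μ := by
  rcases isEmpty_or_nonempty X with hX | ⟨⟨x₀⟩⟩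
  · have : μ = 0 := Measure.eq_zero_of_isEmpty μ
    rw [this]; infer_instance
  · refine ⟨⟨⟨fun n : ℕ => ball x₀ (n + 1), fun _ => trivial, fun n => (h.fin _ _).lt_top, ?_⟩⟩⟩
    rw [eq_univ_iff_forall]
    intro z
    obtain ⟨n, hn⟩ := exists_nat_gt (dist z x₀)
    exact mem_iUnion.2 ⟨n, by simp only [mem_ball]; linarith⟩

theorem locallyFinite : IsLocallyFiniteMeasure μ :=
  ⟨fun x => ⟨ball x 1, ball_mem_nhds x one_pos, (h.fin _ _).lt_top⟩⟩

variable [BorelSpace X]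

theorem countable_of_disjoint {u : Set X} {r : X → ℝ} (hr : ∀ x ∈ u, 0 < r x)
    (hd : u.PairwiseDisjoint fun x => closedBall x (r x)) : u.Countable := by
  have := h.sigmaFinite
  have key := Measure.countable_meas_pos_of_disjoint_iUnion (μ := μ)
    (As := fun x : u => closedBall (x : X) (r x)) (fun _ => measurableSet_closedBall)
    (fun x y hxy => hd x.2 y.2 (fun e => hxy (Subtype.ext e)))
  rw [countable_coe_iff.symm, ← countable_univ_iff]
  convert key using 1
  refine (eq_univ_of_forall fun x => ?_).symm
  exact (h.pos x _ (hr x x.2)).trans_le (measure_mono ball_subset_closedBall)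

/-- Disjoint balls have positive measure, so a disjoint family of them is countable. Second
countability makes open subsets of `X × X` measurable for the product σ-algebra, as Tonelli
requires. -/
theorem secondCountable : SecondCountableTopology X := by
  refine secondCountable_of_almost_dense_set fun ε hε => ?_
  obtain ⟨u, -, hd, hu⟩ := Vitali.exists_disjoint_subfamily_covering_enlargement_closedBall
    (univ : Set X) id (fun _ => ε / 5) (ε / 5) (fun _ _ => le_rfl) 5 (by norm_num)
  refine ⟨u, h.countable_of_disjoint (r := fun _ => ε / 5) (fun _ _ => by positivity) hd,
    fun x => ?_⟩
  obtain ⟨b, hb, hs⟩ := hu x (mem_univ _)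
  refine ⟨b, hb, ?_⟩
  have := hs (mem_closedBall_self (by positivity))
  simpa [mul_div_cancel₀] using this

theorem measurable_measure_ball_dist :
    Measurable fun p : X × X => μ (ball p.1 (dist p.1 p.2)) := by
  have := h.sigmaFinite
  have := h.secondCountable
  have hs : MeasurableSet {q : (X × X) × X | dist q.1.1 q.2 < dist q.1.1 q.1.2} :=
    (isOpen_lt (by fun_prop) (by fun_prop)).measurableSet
  convert measurable_measure_prodMk_left (ν := μ) hs using 3 with p
  ext w
  simp [dist_comm]

theorem measurable_measure_ball (r : ℝ) : Measurable fun x : X => μ (ball x r) := by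
  have := h.sigmaFinite
  have := h.secondCountable
  have hs : MeasurableSet {q : X × X | dist q.2 q.1 < r} :=
    (isOpen_lt (by fun_prop) (by fun_prop)).measurableSet
  exact measurable_measure_prodMk_left (ν := μ) hs

theorem measurable_rieszPole : Measurable fun p : X × X => rieszPole μ p.1 p.2 := by
  have := h.secondCountable
  exact (measurable_dist.ennreal_ofReal).div h.measurable_measure_ball_dist

theorem measurable_rieszPole_right (x : X) : Measurable (rieszPole μ x) :=
  h.measurable_rieszPole.comp measurable_prodMk_left

theorem measurable_rieszKernel (x y : X) : Measurable (rieszKernel μ x y) :=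
  (h.measurable_rieszPole_right x).add (h.measurable_rieszPole_right y)

omit [BorelSpace X] in
theorem rieszPole_symm (x z : X) : rieszPole μ x z ≤ D * rieszPole μ z x := by
  rcases eq_or_ne x z with rfl | hne
  · simp [rieszPole]
  have hd : 0 < dist x z := dist_pos.2 hne
  unfold rieszPole
  rw [dist_comm z x]
  set d := dist x z with hdd
  have h1 : μ (ball z d) ≤ D * μ (ball x d) := by
    refine (measure_mono fun w hw => ?_).trans (h.dbl x d hd)
    rw [mem_ball] at *
    have := dist_triangle w z x
    rw [dist_comm z x] at this
    linarith
  have hx := (h.pos x d hd).ne'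
  have hz := (h.pos z d hd).ne'
  rw [ENNReal.div_le_iff hx (h.fin _ _), ← mul_div_assoc, mul_comm D, mul_div_assoc, mul_assoc]
  refine le_mul_of_one_le_right' ?_
  rw [mul_comm, ← mul_div_assoc, ENNReal.le_div_iff_mul_le (Or.inl hz) (Or.inl (h.fin _ _)),
    one_mul, mul_comm]
  exact h1

/-- Decompose into dyadic annuli. On the `n`-th one the pole is at most `δ 2⁻ⁿ / μ(B(x, δ 2⁻ⁿ⁻¹))`,
and the part of `A` there has at most `η D` times the measure in this denominator; the geometric
series sums to `2δ`. -/
theorem lintegral_rieszPole_le (x : X) {δ : ℝ} (hδ : 0 < δ) {A : Set X} (hA : MeasurableSet A)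
    {η : ℝ≥0∞} (hη : ∀ s, 0 < s → s ≤ δ → μ (A ∩ ball x s) ≤ η * μ (ball x s)) :
    ∫⁻ z in A ∩ ball x δ, rieszPole μ x z ∂μ ≤ η * D * ENNReal.ofReal (2 * δ) := by
  set S : ℕ → Set X := fun n => (A ∩ ball x (δ / 2 ^ n)) \ ball x (δ / 2 ^ (n + 1)) with hS
  have hSm : ∀ n, MeasurableSet (S n) := fun n => (hA.inter measurableSet_ball).diff
    measurableSet_ball
  have hcov : A ∩ ball x δ ⊆ {x} ∪ ⋃ n, S n := by
    rintro z ⟨hzA, hz⟩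
    rcases eq_or_ne z x with rfl | hne
    · exact Or.inl rfl
    have hpos : 0 < dist z x := dist_pos.2 hne
    refine Or.inr (mem_iUnion.2 ?_)
    have hex : ∃ n : ℕ, δ / 2 ^ (n + 1) ≤ dist z x := by
      obtain ⟨n, hn⟩ := exists_pow_lt_of_lt_one (div_pos hpos hδ) (by norm_num : (1 / 2 : ℝ) < 1)
      refine ⟨n, ?_⟩
      rw [lt_div_iff₀ hδ, one_div, inv_pow] at hn
      have h2 : δ / 2 ^ (n + 1) ≤ δ / 2 ^ n :=
        div_le_div_of_nonneg_left hδ.le (by positivity)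
          (pow_le_pow_right₀ (by norm_num) (Nat.le_succ n))
      have h3 : δ / 2 ^ n = (2 ^ n)⁻¹ * δ := by rw [div_eq_inv_mul]
      linarith
    classical
    refine ⟨Nat.find hex, ⟨hzA, ?_⟩, ?_⟩
    · rw [mem_ball]
      rcases Nat.eq_zero_or_pos (Nat.find hex) with h0 | h0
      · rw [h0]; simpa using hz
      · have := Nat.find_min hex (Nat.sub_lt h0 one_pos)
        have e : Nat.find hex - 1 + 1 = Nat.find hex := Nat.sub_add_cancel h0
        rw [e] at this
        exact not_le.1 this
    · rw [mem_ball, not_lt]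
      exact Nat.find_spec hex
  have hn : ∀ n, ∫⁻ z in S n, rieszPole μ x z ∂μ ≤ η * D * ENNReal.ofReal (δ / 2 ^ n) := by
    intro n
    have hp : 0 < δ / 2 ^ (n + 1) := by positivity
    set m := μ (ball x (δ / 2 ^ (n + 1))) with hm
    have hm0 : m ≠ 0 := (h.pos x _ hp).ne'
    have hmt : m ≠ ∞ := h.fin _ _
    have h1 : ∀ z ∈ S n, rieszPole μ x z ≤ ENNReal.ofReal (δ / 2 ^ n) / m := by
      rintro z ⟨⟨-, hz1⟩, hz2⟩
      rw [mem_ball, dist_comm] at hz1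
      rw [mem_ball, not_lt, dist_comm] at hz2
      exact ENNReal.div_le_div (ENNReal.ofReal_le_ofReal hz1.le)
        (measure_mono (ball_subset_ball hz2))
    have h2 : μ (S n) ≤ η * (D * m) := by
      calc μ (S n) ≤ μ (A ∩ ball x (δ / 2 ^ n)) := measure_mono sdiff_subset
        _ ≤ η * μ (ball x (δ / 2 ^ n)) := hη _ (by positivity)
            (div_le_self hδ.le (one_le_pow₀ (by norm_num)))
        _ ≤ η * (D * m) := by
            gcongr
            have := h.dbl x _ hp
            have e : 2 * (δ / 2 ^ (n + 1)) = δ / 2 ^ n := by field_simp; ring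
            rwa [e] at this
    calc ∫⁻ z in S n, rieszPole μ x z ∂μ
        ≤ ∫⁻ _ in S n, ENNReal.ofReal (δ / 2 ^ n) / m ∂μ := setLIntegral_mono' (hSm n) h1
      _ = ENNReal.ofReal (δ / 2 ^ n) / m * μ (S n) := setLIntegral_const _ _
      _ ≤ ENNReal.ofReal (δ / 2 ^ n) / m * (η * (D * m)) := by gcongr
      _ = η * D * (ENNReal.ofReal (δ / 2 ^ n) / m * m) := by ring
      _ = η * D * ENNReal.ofReal (δ / 2 ^ n) := by rw [ENNReal.div_mul_cancel hm0 hmt]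
  calc ∫⁻ z in A ∩ ball x δ, rieszPole μ x z ∂μ
      ≤ ∫⁻ z in {x} ∪ ⋃ n, S n, rieszPole μ x z ∂μ := lintegral_mono_set hcov
    _ ≤ ∫⁻ z in {x}, rieszPole μ x z ∂μ + ∫⁻ z in ⋃ n, S n, rieszPole μ x z ∂μ :=
        lintegral_union_le _ _ _
    _ ≤ 0 + ∑' n, ∫⁻ z in S n, rieszPole μ x z ∂μ := by
        gcongr
        -- The center may be an atom, but the pole there is `0 / 0 = 0`.
        · rw [lintegral_singleton]; simp [rieszPole]
        · exact lintegral_iUnion_le _ _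
    _ ≤ ∑' n : ℕ, η * D * ENNReal.ofReal (δ / 2 ^ n) := by
        rw [zero_add]; exact ENNReal.tsum_le_tsum hn
    _ = η * D * ENNReal.ofReal (2 * δ) := by
        rw [ENNReal.tsum_mul_left, ← ENNReal.ofReal_tsum_of_nonneg (fun n => by positivity)]
        · have := tsum_geometric_two' (2 * δ)
          simp only [mul_div_cancel_left₀ δ (two_ne_zero' ℝ)] at this
          rw [this]
        · have := summable_geometric_two' (2 * δ)
          simpa only [mul_div_cancel_left₀ δ (two_ne_zero' ℝ)] using this

theorem lintegral_ball_rieszPole_le (x : X) {δ : ℝ} (hδ : 0 < δ) :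
    ∫⁻ z in ball x δ, rieszPole μ x z ∂μ ≤ D * ENNReal.ofReal (2 * δ) := by
  simpa using h.lintegral_rieszPole_le x hδ MeasurableSet.univ (η := 1) (by simp)

theorem lintegral_rieszPole_left_le (z : X) {δ : ℝ} (hδ : 0 < δ) :
    ∫⁻ x in ball z δ, rieszPole μ x z ∂μ ≤ D * (D * ENNReal.ofReal (2 * δ)) := by
  calc ∫⁻ x in ball z δ, rieszPole μ x z ∂μ ≤ ∫⁻ x in ball z δ, D * rieszPole μ z x ∂μ :=
        lintegral_mono fun x => h.rieszPole_symm x z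
    _ = D * ∫⁻ x in ball z δ, rieszPole μ z x ∂μ := lintegral_const_mul' _ _ h.ne_top
    _ ≤ _ := by gcongr; exact h.lintegral_ball_rieszPole_le z hδ

theorem lintegral_lintegral_rieszPole_le {B S : Set X} (x₀ : X) {R : ℝ} (hR : 0 < R)
    (hB : B ⊆ ball x₀ R) (hS : S ⊆ ball x₀ R) (hSm : MeasurableSet S) {g : X → ℝ≥0∞}
    (hg : Measurable g) :
    ∫⁻ x in B, ∫⁻ z in S, g z * rieszPole μ x z ∂μ ∂μ ≤
      D * (D * ENNReal.ofReal (4 * R)) * ∫⁻ z in S, g z ∂μ := by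
  have := h.sigmaFinite
  rw [lintegral_lintegral_swap]
  · rw [← lintegral_const_mul _ hg]
    refine setLIntegral_mono' hSm fun z hz => ?_
    have hm : Measurable fun x => rieszPole μ x z :=
      h.measurable_rieszPole.comp measurable_prodMk_right
    rw [lintegral_const_mul _ hm, mul_comm]
    gcongr
    have hsub : B ⊆ ball z (2 * R) := fun x hx => by
      have h1 := hB hx
      have h2 := hS hz
      rw [mem_ball] at *
      have := dist_triangle_right x z x₀
      linarith
    refine (lintegral_mono_set hsub).trans ((h.lintegral_rieszPole_left_le z (by positivity)).trans
      (le_of_eq ?_))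
    ring_nf
  · exact ((hg.comp measurable_snd).mul h.measurable_rieszPole).aemeasurable

omit [BorelSpace X] in
theorem isUnifLocDoublingMeasure : IsUnifLocDoublingMeasure μ := by
  refine ⟨⟨(D ^ 2).toNNReal, ?_⟩⟩
  filter_upwards [self_mem_nhdsWithin] with ε hε x
  have hε : 0 < ε := hε
  rw [ENNReal.coe_toNNReal (ENNReal.pow_ne_top h.ne_top)]
  calc μ (closedBall x (2 * ε)) ≤ μ (ball x (2 ^ 2 * ε)) :=
        measure_mono (closedBall_subset_ball (by linarith))
    _ ≤ D ^ 2 * μ (ball x ε) := h.measure_pow x hε 2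
    _ ≤ _ := by gcongr; exact ball_subset_closedBall

theorem ae_density {S : Set X} (hS : MeasurableSet S) :
    ∀ᵐ x ∂μ, x ∈ S → ∀ η : ℝ≥0∞, 0 < η →
      ∀ᶠ s in 𝓝[>] (0 : ℝ), μ (Sᶜ ∩ ball x s) ≤ η * μ (ball x s) := by
  have := h.isUnifLocDoublingMeasure
  have := h.secondCountable
  have := h.locallyFinite
  filter_upwards [(IsUnifLocDoublingMeasure.vitaliFamily μ
    1).ae_tendsto_measure_inter_div_of_measurableSet hS.compl] with x hx hxS η hη
  have ht := hx.comp (IsUnifLocDoublingMeasure.tendsto_closedBall_filterAt μ (K := 1) (x := x)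
    (l := 𝓝[>] (0 : ℝ)) (fun _ => x) (fun s => s) tendsto_id (by
      filter_upwards [self_mem_nhdsWithin] with s hs
      have hs : 0 < s := hs
      exact mem_closedBall_self (by linarith)))
  rw [indicator_of_notMem (by simpa using hxS)] at ht
  -- The division by `D` pays for passing from closed to open balls.
  have hη' : 0 < η / D := ENNReal.div_pos hη.ne' h.ne_top
  filter_upwards [ht.eventually (gt_mem_nhds hη'), self_mem_nhdsWithin] with s hs hs0
  have hs0 : 0 < s := hs0
  have hc0 : μ (closedBall x s) ≠ 0 :=
    ((h.pos x s hs0).trans_le (measure_mono ball_subset_closedBall)).ne'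
  have hc1 : μ (closedBall x s) ≤ D * μ (ball x s) :=
    (measure_mono (closedBall_subset_ball (by linarith))).trans (h.dbl x s hs0)
  have hct : μ (closedBall x s) ≠ ∞ :=
    ne_top_of_le_ne_top (ENNReal.mul_ne_top h.ne_top (h.fin _ _)) hc1
  have h1 := (ENNReal.div_le_iff hc0 hct).1 hs.le
  calc μ (Sᶜ ∩ ball x s) ≤ μ (Sᶜ ∩ closedBall x s) := by
        gcongr; exact ball_subset_closedBall
    _ ≤ η / D * μ (closedBall x s) := h1
    _ ≤ η / D * (D * μ (ball x s)) := by gcongr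
    _ = η * μ (ball x s) := by
        rw [← mul_assoc, ENNReal.div_mul_cancel h.D_ne_zero h.ne_top]

/-- Almost every point is a density point of every set `{|v - q| < 1/(n+1)}` containing it, with `q`
rational and `v` a Borel representative; countably many sets suffice. -/
theorem ae_approx_continuous {u : X → ℝ} (hu : AEMeasurable u μ) :
    ∀ᵐ x ∂μ, ∀ ε : ℝ, 0 < ε → ∀ η : ℝ≥0∞, 0 < η →
      ∀ᶠ s in 𝓝[>] (0 : ℝ), μ ({z | ε < |u z - u x|} ∩ ball x s) ≤ η * μ (ball x s) := by
  set v := hu.mk u with hv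
  have hvm : Measurable v := hu.measurable_mk
  have hS : ∀ (q : ℚ) (n : ℕ), MeasurableSet {z | |v z - q| < 1 / ((n : ℝ) + 1)} := fun q n =>
    measurableSet_lt (by fun_prop) measurable_const
  have hall : ∀ᵐ x ∂μ, ∀ (q : ℚ) (n : ℕ), _ :=
    ae_all_iff.2 fun q => ae_all_iff.2 fun n => h.ae_density (hS q n)
  filter_upwards [hall, hu.ae_eq_mk] with x hx hux ε hε η hη
  obtain ⟨n, hn⟩ := exists_nat_one_div_lt (half_pos hε)
  have hn0 : 0 < 1 / ((n : ℝ) + 1) := by positivity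
  obtain ⟨q, hq1, hq2⟩ := exists_rat_btwn (show v x - 1 / ((n : ℝ) + 1) < v x by linarith)
  have hxq : |v x - q| < 1 / ((n : ℝ) + 1) := by rw [abs_lt]; constructor <;> linarith
  filter_upwards [hx q n hxq η hη] with s hs
  refine le_trans ?_ hs
  have hnull : μ {z | ¬ u z = v z} = 0 := hu.ae_eq_mk
  calc μ ({z | ε < |u z - u x|} ∩ ball x s)
      ≤ μ (({z | |v z - q| < 1 / ((n : ℝ) + 1)}ᶜ ∩ ball x s) ∪ {z | ¬ u z = v z}) := by
        refine measure_mono ?_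
        rintro z ⟨hz, hzb⟩
        by_cases huz : u z = v z
        · refine Or.inl ⟨fun hz' => ?_, hzb⟩
          have hz : ε < |u z - u x| := hz
          have hz' : |v z - q| < 1 / ((n : ℝ) + 1) := hz'
          rw [huz, hux] at hz
          have := abs_sub_le (v z) q (v x)
          rw [abs_sub_comm (q : ℝ) (v x)] at this
          linarith
        · exact Or.inr huz
    _ ≤ μ ({z | |v z - q| < 1 / ((n : ℝ) + 1)}ᶜ ∩ ball x s) + μ {z | ¬ u z = v z} :=
        measure_union_le _ _
    _ = _ := by rw [hnull, add_zero]

end DoublingWith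

end

/-! ### Pencils: from sets to functions. -/

noncomputable section

variable {X : Type*} [MetricSpace X] [MeasurableSpace X] [BorelSpace X]

/-- `σ` is a pencil of curves joining `x` to `y`, with constant `C`. -/
structure IsPencil (μ : Measure X) (C : ℝ) (x y : X) {Γ : Set (RectCurve X)} [MeasurableSpace Γ]
    (σ : Measure Γ) : Prop where
  prob : IsProbabilityMeasure σ
  joins : ∀ γ ∈ Γ, γ.toFun γ.a = x ∧ γ.toFun γ.b = y
  trace_le : ∀ A : Set X, MeasurableSet A →
    AEMeasurable (fun γ : Γ => Measure.hausdorffMeasure 1 (γ.1.trace ∩ A)) σ ∧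
    ∫⁻ γ : Γ, Measure.hausdorffMeasure 1 (γ.1.trace ∩ A) ∂σ ≤
      ENNReal.ofReal C * ∫⁻ z in twoBalls C x y ∩ A, rieszKernel μ x y z ∂μ

omit [MetricSpace X] [BorelSpace X] in
theorem lintegral_lintegral_restrict_le {Ω : Type*} [MeasurableSpace Ω] {σ : Measure Ω}
    {H ν : Measure X} {T : Ω → Set X} {K : ℝ≥0∞}
    (hK : ∀ A : Set X, MeasurableSet A → AEMeasurable (fun ω => H (T ω ∩ A)) σ ∧
      ∫⁻ ω, H (T ω ∩ A) ∂σ ≤ K * ν A) {ρ : X → ℝ≥0∞} (hρ : Measurable ρ) :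
    AEMeasurable (fun ω => ∫⁻ z in T ω, ρ z ∂H) σ ∧
      ∫⁻ ω, ∫⁻ z in T ω, ρ z ∂H ∂σ ≤ K * ∫⁻ z, ρ z ∂ν := by
  refine Measurable.ennreal_induction (motive := fun ρ =>
    AEMeasurable (fun ω => ∫⁻ z in T ω, ρ z ∂H) σ ∧
      ∫⁻ ω, ∫⁻ z in T ω, ρ z ∂H ∂σ ≤ K * ∫⁻ z, ρ z ∂ν) ?_ ?_ ?_ hρ
  · intro c A hA
    have e : ∀ ω, ∫⁻ z in T ω, A.indicator (fun _ => c) z ∂H = c * H (T ω ∩ A) := fun ω => by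
      rw [lintegral_indicator_const hA, Measure.restrict_apply hA, inter_comm]
    simp only [e, lintegral_indicator_const hA]
    refine ⟨(hK A hA).1.const_mul c, ?_⟩
    rw [lintegral_const_mul'' _ (hK A hA).1, mul_left_comm]
    gcongr
    exact (hK A hA).2
  · intro f g _ hf hg ihf ihg
    simp only [Pi.add_apply, lintegral_add_left hf]
    refine ⟨ihf.1.add ihg.1, ?_⟩
    rw [lintegral_add_left' ihf.1, mul_add]
    exact add_le_add ihf.2 ihg.2
  · intro f hf hmono ih
    have e : ∀ ω, ∫⁻ z in T ω, (⨆ n, f n z) ∂H = ⨆ n, ∫⁻ z in T ω, f n z ∂H := fun ω =>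
      lintegral_iSup hf hmono
    simp only [e]
    refine ⟨AEMeasurable.iSup fun n => (ih n).1, ?_⟩
    rw [lintegral_iSup' (fun n => (ih n).1) (Eventually.of_forall fun ω i j hij =>
      lintegral_mono fun z => hmono hij z)]
    refine iSup_le fun n => (ih n).2.trans ?_
    gcongr with z
    exact le_iSup (fun n => f n z) n

namespace IsPencil

variable {μ : Measure X} {C : ℝ} {x y : X} {Γ : Set (RectCurve X)} [MeasurableSpace Γ]
  {σ : Measure Γ}

theorem lintegral_trace_le (hσ : IsPencil μ C x y σ) (hR : Measurable (rieszKernel μ x y))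
    {ρ : X → ℝ≥0∞} (hρ : Measurable ρ) :
    AEMeasurable (fun γ : Γ => ∫⁻ z in γ.1.trace, ρ z ∂Measure.hausdorffMeasure 1) σ ∧
      ∫⁻ γ : Γ, ∫⁻ z in γ.1.trace, ρ z ∂Measure.hausdorffMeasure 1 ∂σ ≤
        ENNReal.ofReal C * ∫⁻ z in twoBalls C x y, ρ z * rieszKernel μ x y z ∂μ := by
  have := lintegral_lintegral_restrict_le (σ := σ) (H := Measure.hausdorffMeasure 1)
    (ν := (μ.restrict (twoBalls C x y)).withDensity (rieszKernel μ x y))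
    (T := fun γ : Γ => γ.1.trace) (K := ENNReal.ofReal C) (fun A hA => ?_) hρ
  · rw [lintegral_withDensity_eq_lintegral_mul _ hR hρ] at this
    simpa only [Pi.mul_apply, mul_comm] using this
  · rw [withDensity_apply _ hA, Measure.restrict_restrict hA, inter_comm A]
    exact hσ.trace_le A hA

end IsPencil

theorem SupportsSemmesPencil.exists_isPencil {μ : Measure X} (hX : SupportsSemmesPencil μ) :
    ∃ C : ℝ, 0 < C ∧ ∀ x y : X, x ≠ y →
      ∃ (Γ : Set (RectCurve X)) (_ : MeasurableSpace Γ) (σ : Measure Γ), IsPencil μ C x y σ := by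
  obtain ⟨C, hC, h⟩ := hX
  refine ⟨C, hC, fun x y hxy => ?_⟩
  obtain ⟨Γ, mΓ, σ, h1, h2, h3⟩ := h x y hxy
  exact ⟨Γ, mΓ, σ, h1, fun γ hγ => ⟨(h2 γ hγ).1, (h2 γ hγ).2.1⟩, h3⟩

theorem IsPencil.nonempty {μ : Measure X} {C : ℝ} {x y : X} {Γ : Set (RectCurve X)}
    [MeasurableSpace Γ] {σ : Measure Γ} (hσ : IsPencil μ C x y σ) : Nonempty Γ := by
  have := hσ.prob
  exact σ.nonempty_of_neZero

omit [MeasurableSpace X] [BorelSpace X] in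
theorem twoBalls_subset_ball {C : ℝ} {x y x₀ : X} {r d : ℝ} (hC : 0 < C) (hx : dist x x₀ ≤ r)
    (hy : dist y x₀ ≤ r) (hd : dist x y ≤ d) : twoBalls C x y ⊆ ball x₀ (C * d + r) := by
  have h1 : C * dist x y ≤ C * d := mul_le_mul_of_nonneg_left hd hC.le
  rintro z (hz | hz)
  · rw [mem_ball] at *
    linarith [dist_triangle z x x₀]
  · rw [mem_ball] at *
    linarith [dist_triangle z y x₀]

/-! ### Finite lower one-dimensional density almost everywhere. -/

section LowerDensity

variable (μ : Measure X)

/-- The points at which `μ` has finite lower one-dimensional density along dyadic radii. -/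
def finiteLowerDensitySet : Set X :=
  {x | ∃ M : ℕ, ∃ᶠ n : ℕ in atTop, μ (ball x ((1 / 2) ^ n)) ≤ M * ENNReal.ofReal ((1 / 2) ^ n)}

variable {μ} {D : ℝ≥0∞} (h : DoublingWith μ D)
include h

theorem DoublingWith.measurableSet_finiteLowerDensitySet :
    MeasurableSet (finiteLowerDensitySet μ) := by
  have : finiteLowerDensitySet μ = ⋃ M : ℕ, ⋂ N : ℕ, ⋃ n : ℕ, ⋃ _ : N ≤ n,
      {x | μ (ball x ((1 / 2) ^ n)) ≤ M * ENNReal.ofReal ((1 / 2) ^ n)} := by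
    ext x
    simp [finiteLowerDensitySet, frequently_atTop]
  rw [this]
  refine MeasurableSet.iUnion fun M => MeasurableSet.iInter fun N => MeasurableSet.iUnion fun n =>
    MeasurableSet.iUnion fun _ => measurableSet_le (h.measurable_measure_ball _) measurable_const

/-- Off the set, small dyadic balls satisfy `μ(B) > (k+1)·radius` for every `k`. A Vitali family of
such balls has total diameter at most a multiple of `μ(B(x₀, R+1))/(k+1)`, which tends to `0`. -/
theorem DoublingWith.hausdorffMeasure_compl_finiteLowerDensitySet :
    Measure.hausdorffMeasure 1 (finiteLowerDensitySet μ)ᶜ = 0 := by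
  rcases isEmpty_or_nonempty X with hX | ⟨⟨x₀⟩⟩
  · simp [Set.eq_empty_of_isEmpty]
  set E := (finiteLowerDensitySet μ)ᶜ with hE
  have hcov : E ⊆ ⋃ R : ℕ, E ∩ ball x₀ R := by
    intro z hz
    obtain ⟨n, hn⟩ := exists_nat_gt (dist z x₀)
    exact mem_iUnion.2 ⟨n, hz, hn⟩
  refine measure_mono_null hcov (measure_iUnion_null fun R => ?_)
  have hpick : ∀ (k : ℕ) (x : X), x ∈ E → ∃ n : ℕ, k ≤ n ∧
      ((k + 1 : ℕ) : ℝ≥0∞) * ENNReal.ofReal ((1 / 2) ^ n) < μ (ball x ((1 / 2) ^ n)) := by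
    intro k x hx
    simp only [hE, finiteLowerDensitySet, mem_compl_iff, mem_ofPred_eq, not_exists,
      not_frequently, not_le] at hx
    obtain ⟨n, hn, hkn⟩ := ((hx (k + 1)).and (eventually_ge_atTop k)).exists
    exact ⟨n, hkn, hn⟩
  choose! N hN1 hN2 using hpick
  have hvit := fun k : ℕ => Vitali.exists_disjoint_subfamily_covering_enlargement_closedBall
    (E ∩ ball x₀ R) id (fun x => (1 / 2 : ℝ) ^ N k x) ((1 / 2 : ℝ) ^ k)
    (fun x hx => pow_le_pow_of_le_one (by norm_num) (by norm_num) (hN1 k x hx.1)) 5 (by norm_num)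
  choose u hut hud huc using hvit
  have hcount : ∀ k, Countable (u k) := fun k =>
    (h.countable_of_disjoint (r := fun x => (1 / 2 : ℝ) ^ N k x) (fun _ _ => by positivity)
      (hud k)).to_subtype
  have hdiam : ∀ (k : ℕ) (x : X), ediam (closedBall x (5 * (1 / 2 : ℝ) ^ N k x)) ≤
      10 * ENNReal.ofReal ((1 / 2) ^ N k x) := by
    intro k x
    have hp : (0 : ℝ) ≤ 5 * (1 / 2 : ℝ) ^ N k x := by positivity
    rw [← closedEBall_ofReal hp]
    refine ediam_closedEBall_le.trans (le_of_eq ?_)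
    rw [ENNReal.ofReal_mul (by norm_num), ← mul_assoc]
    norm_num
  have hle := Measure.hausdorffMeasure_le_liminf_tsum (ι := fun k => u k) 1 (E ∩ ball x₀ R)
    (l := atTop) (fun k : ℕ => 10 * ENNReal.ofReal ((1 / 2) ^ k)) ?_
    (fun k b => closedBall (b : X) (5 * (1 / 2 : ℝ) ^ N k b)) ?_ ?_
  · refine le_antisymm (hle.trans ?_) zero_le
    have hbound : ∀ k : ℕ, ∑' b : u k, ediam (closedBall (b : X) (5 * (1 / 2 : ℝ) ^ N k b)) ^ (1 : ℝ)
        ≤ 10 * μ (ball x₀ (R + 1)) * ((k + 1 : ℕ) : ℝ≥0∞)⁻¹ := by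
      intro k
      have h1 : ∀ b : u k, ediam (closedBall (b : X) (5 * (1 / 2 : ℝ) ^ N k b)) ^ (1 : ℝ) ≤
          10 * ((k + 1 : ℕ) : ℝ≥0∞)⁻¹ * μ (ball (b : X) ((1 / 2) ^ N k b)) := by
        intro b
        rw [ENNReal.rpow_one, mul_assoc]
        refine (hdiam k b).trans ?_
        gcongr
        have := (hN2 k b (hut k b.2).1).le
        rw [mul_comm, ← div_eq_mul_inv, ENNReal.le_div_iff_mul_le (Or.inl (by simp))
          (Or.inl (by simp)), mul_comm]
        exact this
      refine (ENNReal.tsum_le_tsum h1).trans ?_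
      rw [ENNReal.tsum_mul_left, mul_right_comm]
      gcongr
      rw [← measure_iUnion]
      · refine measure_mono (iUnion_subset fun b z hz => ?_)
        have hb := (hut k b.2).2
        have h1 : (1 / 2 : ℝ) ^ N k b ≤ 1 := pow_le_one₀ (by norm_num) (by norm_num)
        rw [mem_ball] at *
        linarith [dist_triangle z b x₀]
      · intro b c hbc
        exact (hud k b.2 c.2 (fun e => hbc (Subtype.ext e))).mono ball_subset_closedBall
          ball_subset_closedBall
      · exact fun b => measurableSet_ball
    refine (liminf_le_liminf (Eventually.of_forall hbound)).trans (le_of_eq ?_)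
    refine Tendsto.liminf_eq ?_
    have := (ENNReal.Tendsto.const_mul (ENNReal.tendsto_inv_nat_nhds_zero.comp
      (tendsto_add_atTop_nat 1)) (Or.inr (ENNReal.mul_ne_top (by simp) (h.fin x₀ (R + 1))))
      : Tendsto (fun k : ℕ => 10 * μ (ball x₀ (R + 1)) * ((k + 1 : ℕ) : ℝ≥0∞)⁻¹) atTop _)
    simpa using this
  · have h1 : Tendsto (fun k : ℕ => ENNReal.ofReal ((1 / 2) ^ k)) atTop (𝓝 0) := by
      rw [← ENNReal.ofReal_zero]
      exact ENNReal.tendsto_ofReal (tendsto_pow_atTop_nhds_zero_of_lt_one (by norm_num)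
        (by norm_num))
    simpa using ENNReal.Tendsto.const_mul h1 (Or.inr (by simp : (10 : ℝ≥0∞) ≠ ∞))
  · refine Eventually.of_forall fun k b => (hdiam k b).trans ?_
    gcongr 10 * ENNReal.ofReal ?_
    exact pow_le_pow_of_le_one (by norm_num) (by norm_num) (hN1 k b (hut k b.2).1)
  · refine Eventually.of_forall fun k z hz => ?_
    obtain ⟨b, hb, hs⟩ := huc k z hz
    exact mem_iUnion.2 ⟨⟨b, hb⟩, hs (mem_closedBall_self (by positivity))⟩

/-- Let `x` be a density point of the complement of `F`. Curves from `x` to `y` have all their `H^1`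
measure in `F`, so `d(x,y)` is at most `C` times the kernel integral over `F`. Averaging over `y` in
a ball `W` at distance comparable to `r` from `x` also tames the pole at `y`, and sparsity of `F`
near `x` gives the contradiction `r/4 ≤ ηQr` with `ηQ < 1/4`. In a one-point space the set is empty,
hence `Nontrivial`. -/
theorem DoublingWith.measure_compl_finiteLowerDensitySet [Nontrivial X] {C : ℝ} (hC : 0 < C)
    (hX : ∀ x y : X, x ≠ y →
      ∃ (Γ : Set (RectCurve X)) (_ : MeasurableSpace Γ) (σ : Measure Γ), IsPencil μ C x y σ) :
    μ (finiteLowerDensitySet μ)ᶜ = 0 := by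
  have hH := h.hausdorffMeasure_compl_finiteLowerDensitySet
  set F := finiteLowerDensitySet μ with hF
  have hFm : MeasurableSet F := h.measurableSet_finiteLowerDensitySet
  refine measure_mono_null ?_ (h.ae_density hFm.compl)
  intro x hx hdens
  have hdens := hdens hx
  rw [compl_compl] at hdens
  obtain ⟨y', hy'⟩ := exists_ne x
  set Λ : ℝ := C + 1 with hΛ
  -- `8Λ · r/4 = 2Λr`, so `m` doublings of `W = B(p, r/4)` cover `B(x, Λr)`.
  obtain ⟨m, hm⟩ := pow_unbounded_of_one_lt (8 * Λ) (by norm_num : (1 : ℝ) < 2)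
  set Q : ℝ≥0∞ := ENNReal.ofReal C * (D * ENNReal.ofReal (2 * Λ) +
    D * (D * ENNReal.ofReal (4 * Λ)) * D ^ m) with hQ
  have hQt : Q ≠ ∞ := by
    have := h.ne_top
    have h2 := ENNReal.pow_ne_top (n := m) this
    rw [hQ]
    finiteness
  obtain ⟨η, hη0, hη⟩ := ENNReal.exists_nnreal_pos_mul_lt hQt
    (show ENNReal.ofReal (1 / 4) ≠ 0 by simp)
  obtain ⟨s₀, hs₀, hs⟩ := mem_nhdsGT_iff_exists_Ioc_subset.1 (hdens η (by exact_mod_cast hη0))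
  have hs₀ : 0 < s₀ := hs₀
  have hd' : 0 < dist x y' := dist_pos.2 hy'.symm
  have hΛ1 : 1 < Λ := by linarith
  set r : ℝ := min (s₀ / Λ) (dist x y') with hr
  have hr0 : 0 < r := lt_min (by positivity) hd'
  have hΛr : Λ * r ≤ s₀ := by
    have := min_le_left (s₀ / Λ) (dist x y')
    rw [← hr, le_div_iff₀ (by positivity)] at this
    linarith
  have hΛr0 : 0 < Λ * r := by positivity
  have hdensr : ∀ s, 0 < s → s ≤ Λ * r → μ (F ∩ ball x s) ≤ η * μ (ball x s) :=
    fun s h1 h2 => hs ⟨h1, h2.trans hΛr⟩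
  -- Any curve of a pencil from `x` to `y'` crosses the sphere of radius `r/2`.
  obtain ⟨p, hp⟩ : ∃ p, dist x p = r / 2 := by
    obtain ⟨Γ, mΓ, σ, hσ⟩ := hX x y' hy'.symm
    obtain ⟨γ, hγ⟩ := hσ.nonempty
    have hcont : ContinuousOn (fun t => dist x (γ.toFun t)) (Icc γ.a γ.b) :=
      (continuous_const.dist continuous_id).comp_continuousOn γ.continuousOn
    obtain ⟨t, -, ht⟩ := intermediate_value_Icc γ.le hcont 
      (show r / 2 ∈ Icc (dist x (γ.toFun γ.a)) (dist x (γ.toFun γ.b)) by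
      simp only [(hσ.joins γ hγ).1, (hσ.joins γ hγ).2, dist_self]
      have := min_le_right (s₀ / Λ) (dist x y')
      exact ⟨by positivity, by linarith⟩)
    exact ⟨_, ht⟩
  set W := ball p (r / 4) with hW
  set S := F ∩ ball x (Λ * r) with hS
  have hSm : MeasurableSet S := hFm.inter measurableSet_ball
  have hWd : ∀ y ∈ W, r / 4 ≤ dist x y ∧ dist x y ≤ r := by
    intro y hy
    rw [hW, mem_ball] at hy
    have h1 := dist_triangle x y p
    have h2 := dist_triangle_right x y p
    constructor <;> linarith
  have hcurve : ∀ y ∈ W, ENNReal.ofReal (r / 4) ≤ ENNReal.ofReal C *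
      (∫⁻ z in S, rieszPole μ x z ∂μ + ∫⁻ z in S, 1 * rieszPole μ y z ∂μ) := by
    intro y hy
    obtain ⟨h1, h2⟩ := hWd y hy
    have hxy : x ≠ y := dist_pos.1 (by linarith)
    obtain ⟨Γ, mΓ, σ, hσ⟩ := hX x y hxy
    have := hσ.prob
    have hpt : ∀ γ : Γ, ENNReal.ofReal (r / 4) ≤
        Measure.hausdorffMeasure 1 (γ.1.trace ∩ F) := by
      intro γ
      have e1 := γ.1.edist_le_hausdorffMeasure_trace
      rw [(hσ.joins γ γ.2).1, (hσ.joins γ γ.2).2, edist_dist] at e1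
      refine (ENNReal.ofReal_le_ofReal h1).trans (e1.trans ?_)
      rw [← inter_union_compl γ.1.trace F]
      refine (measure_union_le _ _).trans (le_of_eq ?_)
      rw [measure_mono_null inter_subset_right hH, add_zero, inter_union_compl]
    calc ENNReal.ofReal (r / 4) = ∫⁻ _ : Γ, ENNReal.ofReal (r / 4) ∂σ := by simp
      _ ≤ ∫⁻ γ : Γ, Measure.hausdorffMeasure 1 (γ.1.trace ∩ F) ∂σ := lintegral_mono hpt
      _ ≤ _ := (hσ.trace_le F hFm).2
      _ ≤ ENNReal.ofReal C * ∫⁻ z in S, rieszKernel μ x y z ∂μ := by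
          gcongr
          refine fun z hz => ⟨hz.2, ?_⟩
          have := twoBalls_subset_ball hC (x₀ := x) (r := r) (by simpa using hr0.le)
            (by rwa [dist_comm]) h2 hz.1
          rwa [show C * r + r = Λ * r by rw [hΛ]; ring] at this
      _ = _ := by
          simp only [rieszKernel_eq, one_mul]
          rw [lintegral_add_left (h.measurable_rieszPole_right x)]
  have hWpos : μ W ≠ 0 := (h.pos p _ (by positivity)).ne'
  have hWfin : μ W ≠ ∞ := h.fin _ _
  have hSμ : μ S ≤ η * (D ^ m * μ W) := by
    refine (hdensr _ hΛr0 le_rfl).trans ?_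
    gcongr
    refine le_trans (measure_mono fun z hz => ?_) (h.measure_pow p (by positivity) m)
    rw [mem_ball] at *
    have h1 := dist_triangle z x p
    have h2 : 8 * Λ * (r / 4) ≤ 2 ^ m * (r / 4) := by gcongr
    have h3 : r ≤ Λ * r := by nlinarith
    linarith
  have hWS : W ⊆ ball x (Λ * r) := fun y hy => by
    rw [hW, mem_ball] at hy
    rw [mem_ball]
    have h1 := dist_triangle y p x
    rw [dist_comm p x] at h1
    have h3 : r ≤ Λ * r := by nlinarith
    linarith
  have hkey : ENNReal.ofReal (r / 4) * μ W ≤ η * Q * ENNReal.ofReal r * μ W := by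
    calc ENNReal.ofReal (r / 4) * μ W = ∫⁻ _ in W, ENNReal.ofReal (r / 4) ∂μ :=
          (setLIntegral_const _ _).symm
      _ ≤ ∫⁻ y in W, ENNReal.ofReal C *
            (∫⁻ z in S, rieszPole μ x z ∂μ + ∫⁻ z in S, 1 * rieszPole μ y z ∂μ) ∂μ :=
          setLIntegral_mono' measurableSet_ball hcurve
      _ = ENNReal.ofReal C * ((∫⁻ z in S, rieszPole μ x z ∂μ) * μ W +
            ∫⁻ y in W, ∫⁻ z in S, 1 * rieszPole μ y z ∂μ ∂μ) := by
          rw [lintegral_const_mul' _ _ ENNReal.ofReal_ne_top, lintegral_add_left measurable_const,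
            setLIntegral_const]
      _ ≤ ENNReal.ofReal C * ((η * D * ENNReal.ofReal (2 * (Λ * r))) * μ W +
            D * (D * ENNReal.ofReal (4 * (Λ * r))) * (η * (D ^ m * μ W))) := by
          gcongr
          · exact h.lintegral_rieszPole_le x hΛr0 hFm hdensr
          · refine (h.lintegral_lintegral_rieszPole_le x hΛr0 hWS inter_subset_right hSm
              measurable_const).trans ?_
            rw [setLIntegral_const, one_mul]
            gcongr
      _ = η * Q * ENNReal.ofReal r * μ W := by
          rw [← mul_assoc 2 Λ r, ← mul_assoc 4 Λ r, ENNReal.ofReal_mul (by positivity),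
            ENNReal.ofReal_mul (q := r) (by positivity), hQ]
          ring
  rw [ENNReal.mul_le_mul_iff_left hWpos hWfin, div_eq_mul_one_div, mul_comm r,
    ENNReal.ofReal_mul (by norm_num), ENNReal.mul_le_mul_iff_left (by simpa using hr0)
    ENNReal.ofReal_ne_top] at hkey
  exact absurd hkey (not_le.2 hη)

end LowerDensity

end

/-! ### The pointwise estimate along a pencil. -/

noncomputable section

theorem ENNReal.exists_pos_mul_le {K c : ℝ≥0∞} (hK : K ≠ ∞) (hc : c ≠ 0) :
    ∃ θ : ℝ≥0∞, 0 < θ ∧ K * θ ≤ c := by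
  obtain ⟨n, hn, hlt⟩ := ENNReal.exists_nnreal_pos_mul_lt hK hc
  exact ⟨n, by exact_mod_cast hn, by rw [mul_comm]; exact hlt.le⟩

variable {X : Type*} [MetricSpace X] [MeasurableSpace X] [BorelSpace X]

omit [BorelSpace X] in
theorem rieszKernel_comm (μ : Measure X) (x y : X) : rieszKernel μ x y = rieszKernel μ y x :=
  funext fun _ => add_comm _ _

namespace RectCurve

variable (γ : RectCurve X)

/-- Otherwise almost all of `[0, δ)` is mapped into `T ∩ B(γ(a), δ)`, and injectivity forces the
trace to have `H^1` measure at least `δ` there. -/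
theorem exists_param_near_start (hi : InjOn γ.arc (Icc 0 γ.length.toReal)) {δ : ℝ} (hδ : 0 < δ)
    (hδℓ : δ ≤ γ.length.toReal) {T : Set X} (hT : MeasurableSet T)
    (hH : Measure.hausdorffMeasure 1 (γ.trace ∩ (T ∩ ball (γ.toFun γ.a) δ)) < ENNReal.ofReal δ)
    {N : Set ℝ} (hN : volume N = 0) :
    ∃ s ∈ Icc 0 γ.length.toReal \ N, s < δ ∧ γ.arc s ∉ T := by
  by_contra! hcon
  refine absurd hH (not_lt.2 ?_)
  have hsub : Ico 0 δ ⊆ (Icc 0 γ.length.toReal ∩ γ.arc ⁻¹' (T ∩ ball (γ.toFun γ.a) δ)) ∪ N := by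
    intro s hs
    by_cases hsN : s ∈ N
    · exact Or.inr hsN
    have hsI : s ∈ Icc 0 γ.length.toReal := ⟨hs.1, hs.2.le.trans hδℓ⟩
    refine Or.inl ⟨hsI, hcon s ⟨hsI, hsN⟩ hs.2, ?_⟩
    have := γ.dist_arc_le s hsI 0 ⟨le_rfl, hδ.le.trans hδℓ⟩
    rw [γ.arc_zero, sub_zero, abs_of_nonneg hs.1] at this
    exact this.trans_lt hs.2
  calc ENNReal.ofReal δ = volume (Ico 0 δ) := by rw [Real.volume_Ico, sub_zero]
    _ ≤ _ := measure_mono hsub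
    _ ≤ _ := measure_union_le _ _
    _ = _ := by rw [hN, add_zero]
    _ ≤ _ := γ.volume_preimage_arc_le hi (hT.inter measurableSet_ball)

theorem exists_param_near_end (hi : InjOn γ.arc (Icc 0 γ.length.toReal)) {δ : ℝ} (hδ : 0 < δ)
    (hδℓ : δ ≤ γ.length.toReal) {T : Set X} (hT : MeasurableSet T)
    (hH : Measure.hausdorffMeasure 1 (γ.trace ∩ (T ∩ ball (γ.toFun γ.b) δ)) < ENNReal.ofReal δ)
    {N : Set ℝ} (hN : volume N = 0) :
    ∃ t ∈ Icc 0 γ.length.toReal \ N, γ.length.toReal - δ < t ∧ γ.arc t ∉ T := by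
  by_contra! hcon
  refine absurd hH (not_lt.2 ?_)
  have hsub : Ioc (γ.length.toReal - δ) γ.length.toReal ⊆
      (Icc 0 γ.length.toReal ∩ γ.arc ⁻¹' (T ∩ ball (γ.toFun γ.b) δ)) ∪ N := by
    intro s hs
    by_cases hsN : s ∈ N
    · exact Or.inr hsN
    have hsI : s ∈ Icc 0 γ.length.toReal := ⟨by linarith [hs.1], hs.2⟩
    refine Or.inl ⟨hsI, hcon s ⟨hsI, hsN⟩ hs.1, ?_⟩
    have := γ.dist_arc_le s hsI γ.length.toReal ⟨hδ.le.trans hδℓ, le_rfl⟩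
    rw [γ.arc_length, abs_of_nonpos (by linarith [hs.2])] at this
    rw [mem_ball]
    linarith [hs.1]
  calc ENNReal.ofReal δ = volume (Ioc (γ.length.toReal - δ) γ.length.toReal) := by
        rw [Real.volume_Ioc, sub_sub_cancel]
    _ ≤ _ := measure_mono hsub
    _ ≤ _ := measure_union_le _ _
    _ = _ := by rw [hN, add_zero]
    _ ≤ _ := γ.volume_preimage_arc_le hi (hT.inter measurableSet_ball)

end RectCurve

/-- `u` is approximately continuous at `x` with respect to `μ`. -/
def ApproxContinuousAt (μ : Measure X) (u : X → ℝ) (x : X) : Prop :=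
  ∀ ε : ℝ, 0 < ε → ∀ η : ℝ≥0∞, 0 < η →
    ∀ᶠ s in 𝓝[>] (0 : ℝ), μ ({z | ε < |u z - u x|} ∩ ball x s) ≤ η * μ (ball x s)

/-- The pole at `x` contributes `O(ηδ)` by the annulus estimate. The pole at `y` is bounded by a
constant `P` on `B(x, δ)` and contributes `Pημ(B(x,δ)) ≤ PηMδ`, provided `δ` is one of the dyadic
radii witnessing finite lower density. -/
theorem DoublingWith.exists_lintegral_rieszKernel_le {μ : Measure X} {D : ℝ≥0∞}
    (h : DoublingWith μ D) {u : X → ℝ} {x y : X} (hxy : x ≠ y) (hx : x ∈ finiteLowerDensitySet μ)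
    (hu : ApproxContinuousAt μ u x) {ε : ℝ} (hε : 0 < ε) {θ : ℝ≥0∞} (hθ : 0 < θ) :
    ∃ δ, 0 < δ ∧ δ < dist x y / 2 ∧
      ∫⁻ z in toMeasurable μ {z | ε < |u z - u x|} ∩ ball x δ, rieszKernel μ x y z ∂μ ≤
        θ * ENNReal.ofReal δ := by
  have := h.sigmaFinite
  set A := {z | ε < |u z - u x|} with hA
  -- Passing to a measurable hull keeps the measure inside balls, and points off `T` are still off
  -- `A`.
  set T := toMeasurable μ A with hT
  have hTm : MeasurableSet T := measurableSet_toMeasurable _ _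
  set d := dist x y with hd
  have hd0 : 0 < d := dist_pos.2 hxy
  obtain ⟨M, hM⟩ := hx
  set P : ℝ≥0∞ := ENNReal.ofReal (3 / 2 * d) / μ (ball y (d / 2)) with hP
  have hPt : P ≠ ∞ := ENNReal.div_ne_top ENNReal.ofReal_ne_top (h.pos y _ (by positivity)).ne'
  obtain ⟨η, hη0, hη⟩ := ENNReal.exists_pos_mul_le (K := D * 2 + P * M) (c := θ)
    (by have := h.ne_top; finiteness) hθ.ne'
  obtain ⟨s₀, hs₀, hs⟩ := mem_nhdsGT_iff_exists_Ioc_subset.1 (hu ε hε η hη0)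
  have hs₀ : 0 < s₀ := hs₀
  have hev : ∀ᶠ n : ℕ in atTop, ((1 / 2 : ℝ)) ^ n < min s₀ (d / 2) :=
    (tendsto_pow_atTop_nhds_zero_of_lt_one (by norm_num) (by norm_num)).eventually
      (gt_mem_nhds (lt_min hs₀ (by positivity)))
  obtain ⟨n, hn1, hn2⟩ := (hM.and_eventually hev).exists
  set δ : ℝ := (1 / 2) ^ n with hδ
  have hδ0 : 0 < δ := by positivity
  have hδs : δ < s₀ := hn2.trans_le (min_le_left _ _)
  have hδd : δ < d / 2 := hn2.trans_le (min_le_right _ _)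
  have hTs : ∀ s, 0 < s → s ≤ δ → μ (T ∩ ball x s) ≤ η * μ (ball x s) := by
    intro s h1 h2
    rw [hT, Measure.measure_toMeasurable_inter_of_sFinite measurableSet_ball]
    exact hs (show s ∈ Ioc 0 s₀ from ⟨h1, h2.trans hδs.le⟩)
  refine ⟨δ, hδ0, hδd, ?_⟩
  have h1 := h.lintegral_rieszPole_le x hδ0 hTm hTs
  have h2 : ∫⁻ z in T ∩ ball x δ, rieszPole μ y z ∂μ ≤ P * (η * (M * ENNReal.ofReal δ)) := by
    calc ∫⁻ z in T ∩ ball x δ, rieszPole μ y z ∂μ ≤ ∫⁻ _ in T ∩ ball x δ, P ∂μ := by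
          refine setLIntegral_mono' (hTm.inter measurableSet_ball) fun z hz => ?_
          have hz := hz.2
          rw [mem_ball] at hz
          have e1 := dist_triangle y x z
          have e2 := dist_triangle x z y
          rw [dist_comm y x, dist_comm x z] at e1
          rw [dist_comm x z, dist_comm z y] at e2
          refine ENNReal.div_le_div (ENNReal.ofReal_le_ofReal (by linarith))
            (measure_mono (ball_subset_ball (by linarith)))
      _ = P * μ (T ∩ ball x δ) := setLIntegral_const _ _
      _ ≤ _ := by
          gcongr
          refine (hTs δ hδ0 le_rfl).trans ?_
          gcongr
  calc ∫⁻ z in T ∩ ball x δ, rieszKernel μ x y z ∂μ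
      = ∫⁻ z in T ∩ ball x δ, rieszPole μ x z ∂μ + ∫⁻ z in T ∩ ball x δ, rieszPole μ y z ∂μ := by
        simp only [rieszKernel_eq]
        rw [lintegral_add_left (h.measurable_rieszPole_right x)]
    _ ≤ η * D * ENNReal.ofReal (2 * δ) + P * (η * (M * ENNReal.ofReal δ)) := add_le_add h1 h2
    _ = (D * 2 + P * M) * η * ENNReal.ofReal δ := by
        rw [ENNReal.ofReal_mul (by norm_num)]
        simp only [ENNReal.ofReal_ofNat]
        ring
    _ ≤ θ * ENNReal.ofReal δ := by gcongr

namespace IsPencil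

variable {μ : Measure X} {C : ℝ} {x y : X} {Γ : Set (RectCurve X)} [MeasurableSpace Γ]
  {σ : Measure Γ}

theorem lintegral_liminf_trace_le (hσ : IsPencil μ C x y σ) (hR : Measurable (rieszKernel μ x y))
    {ρ : ℕ → X → ℝ≥0∞} (hρ : ∀ i, Measurable (ρ i)) :
    AEMeasurable (fun γ : Γ => liminf (fun i =>
      ∫⁻ z in γ.1.trace, ρ i z ∂Measure.hausdorffMeasure 1) atTop) σ ∧
      ∫⁻ γ : Γ, liminf (fun i => ∫⁻ z in γ.1.trace, ρ i z ∂Measure.hausdorffMeasure 1) atTop ∂σ ≤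
        ENNReal.ofReal C *
          liminf (fun i => ∫⁻ z in twoBalls C x y, ρ i z * rieszKernel μ x y z ∂μ) atTop := by
  refine ⟨?_, ?_⟩
  · simp only [liminf_eq_iSup_iInf_of_nat']
    exact AEMeasurable.iSup fun n => AEMeasurable.iInf fun i =>
      (hσ.lintegral_trace_le hR (hρ (i + n))).1
  refine (lintegral_liminf_le' fun i => (hσ.lintegral_trace_le hR (hρ i)).1).trans ?_
  rw [← ENNReal.liminf_const_mul_of_ne_top ENNReal.ofReal_ne_top]
  exact liminf_le_liminf (Eventually.of_forall fun i => (hσ.lintegral_trace_le hR (hρ i)).2)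

theorem measure_long_trace_le (hσ : IsPencil μ C x y σ) {A : Set X} (hA : MeasurableSet A)
    {δ : ℝ} (hδ : 0 < δ) {θ : ℝ≥0∞}
    (hAθ : ∫⁻ z in A, rieszKernel μ x y z ∂μ ≤ θ * ENNReal.ofReal δ) :
    σ {γ : Γ | ENNReal.ofReal δ ≤ Measure.hausdorffMeasure 1 (γ.1.trace ∩ A)} ≤
      ENNReal.ofReal C * θ := by
  have h1 := mul_meas_ge_le_lintegral₀ (hσ.trace_le A hA).1 (ENNReal.ofReal δ)
  have h2 := h1.trans ((hσ.trace_le A hA).2.trans (mul_le_mul_right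
    ((lintegral_mono_set inter_subset_right).trans hAθ) _))
  rw [← mul_assoc, mul_comm (ENNReal.ofReal δ)] at h2
  exact (ENNReal.mul_le_mul_iff_left (by simpa using hδ) ENNReal.ofReal_ne_top).1 h2

theorem ofReal_abs_sub_le {D : ℝ≥0∞} (h : DoublingWith μ D) (hxy : x ≠ y)
    (hσ : IsPencil μ C x y σ)
    {u : X → ℝ} (hx : x ∈ finiteLowerDensitySet μ) (hy : y ∈ finiteLowerDensitySet μ)
    (hux : ApproxContinuousAt μ u x) (huy : ApproxContinuousAt μ u y)
    {g : ℕ → X → ℝ≥0∞} (hg : ∀ i, Measurable (g i)) {Γ₀ : Set (RectCurve X)}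
    (hu : ∀ γ : RectCurve X, γ ∉ Γ₀ → ∃ N : Set ℝ, volume N = 0 ∧
      ∀ s ∈ Icc 0 γ.length.toReal \ N, ∀ t ∈ Icc 0 γ.length.toReal \ N, s < t →
        ENNReal.ofReal |u (γ.arc t) - u (γ.arc s)| ≤
          liminf (fun i => γ.subpathIntegral s t (g i)) atTop)
    (hΓ₀ : ∀ κ : ℝ≥0∞, 0 < κ → ∃ ρ ∈ AMAdmissible Γ₀,
      liminf (fun i => ∫⁻ z in twoBalls C x y, ρ i z * rieszKernel μ x y z ∂μ) atTop ≤ κ) :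
    ENNReal.ofReal |u x - u y| ≤ 2 * (ENNReal.ofReal C *
      liminf (fun i => ∫⁻ z in twoBalls C x y, g i z * rieszKernel μ x y z ∂μ) atTop) := by
  have := hσ.prob
  have hR := h.measurable_rieszKernel x y
  refine ENNReal.le_of_forall_pos_le_add fun e he _ => ?_
  set ε : ℝ := (e : ℝ) / 2 with hεdef
  have hε : 0 < ε := by positivity
  obtain ⟨θ, hθ0, hθ⟩ := ENNReal.exists_pos_mul_le (K := ENNReal.ofReal C)
    (c := ENNReal.ofReal (1 / 8)) ENNReal.ofReal_ne_top (by simp)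
  obtain ⟨δ₁, hδ₁, hδ₁d, hA₁⟩ := h.exists_lintegral_rieszKernel_le hxy hx hux hε hθ0
  obtain ⟨δ₂, hδ₂, hδ₂d, hA₂⟩ := h.exists_lintegral_rieszKernel_le hxy.symm hy huy hε hθ0
  rw [dist_comm y x] at hδ₂d
  rw [rieszKernel_comm] at hA₂
  set T₁ := toMeasurable μ {z | ε < |u z - u x|} with hT₁
  set T₂ := toMeasurable μ {z | ε < |u z - u y|} with hT₂
  have hT₁m : MeasurableSet T₁ := measurableSet_toMeasurable _ _
  have hT₂m : MeasurableSet T₂ := measurableSet_toMeasurable _ _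
  obtain ⟨ρ, ⟨hρm, hρΓ⟩, hρκ⟩ := hΓ₀ θ hθ0
  have hinj : ∀ γ : Γ, ∃ γ' : RectCurve X, γ'.trace ⊆ γ.1.trace ∧ γ'.toFun γ'.a = x ∧
      γ'.toFun γ'.b = y ∧ InjOn γ'.arc (Icc 0 γ'.length.toReal) := by
    intro γ
    have hj := hσ.joins γ γ.2
    have := γ.1.exists_injOn_arc (by rw [hj.1, hj.2]; exact hxy)
    rwa [hj.1, hj.2] at this
  choose c hctr hca hcb hci using hinj
  have hcint : ∀ (γ : Γ) (f : X → ℝ≥0∞), Measurable f → (c γ).pathIntegral f ≤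
      ∫⁻ z in γ.1.trace, f z ∂Measure.hausdorffMeasure 1 := fun γ f hf =>
    ((c γ).pathIntegral_le_lintegral_trace (hci γ) hf).trans (lintegral_mono_set (hctr γ))
  set Φ : Γ → ℝ≥0∞ := fun γ => liminf (fun i =>
    ∫⁻ z in γ.1.trace, g i z ∂Measure.hausdorffMeasure 1) atTop with hΦ
  obtain ⟨hΦm, hΦle⟩ := hσ.lintegral_liminf_trace_le hR hg
  set B₀ : Set Γ := {γ | c γ ∈ Γ₀} with hB₀
  set B₁ : Set Γ := {γ : Γ | ENNReal.ofReal δ₁ ≤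
    Measure.hausdorffMeasure 1 (γ.1.trace ∩ (T₁ ∩ ball x δ₁))} with hB₁
  set B₂ : Set Γ := {γ : Γ | ENNReal.ofReal δ₂ ≤
    Measure.hausdorffMeasure 1 (γ.1.trace ∩ (T₂ ∩ ball y δ₂))} with hB₂
  have hm₁ : σ B₁ ≤ ENNReal.ofReal (1 / 8) :=
    (hσ.measure_long_trace_le (hT₁m.inter measurableSet_ball) hδ₁ hA₁).trans hθ
  have hm₂ : σ B₂ ≤ ENNReal.ofReal (1 / 8) :=
    (hσ.measure_long_trace_le (hT₂m.inter measurableSet_ball) hδ₂ hA₂).trans hθ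
  have hm₀ : σ B₀ ≤ ENNReal.ofReal (1 / 8) := by
    obtain ⟨hΨm, hΨle⟩ := hσ.lintegral_liminf_trace_le hR hρm
    have h1 := mul_meas_ge_le_lintegral₀ hΨm 1
    rw [one_mul] at h1
    refine (measure_mono ?_).trans (h1.trans (hΨle.trans ((mul_le_mul_right hρκ _).trans hθ)))
    intro γ hγ
    exact (hρΓ (c γ) hγ).trans
      (liminf_le_liminf (Eventually.of_forall fun i => hcint γ _ (hρm i)))
  have hgood : ∀ γ : Γ, γ ∉ B₀ → γ ∉ B₁ → γ ∉ B₂ →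
      ENNReal.ofReal (|u x - u y| - 2 * ε) ≤ Φ γ := by
    intro γ h0 h1 h2
    obtain ⟨N, hN, hNu⟩ := hu (c γ) h0
    have hℓ : dist x y ≤ (c γ).length.toReal := by
      have := (c γ).dist_le_length
      rw [hca, hcb] at this
      exact (ENNReal.ofReal_le_iff_le_toReal (c γ).rectifiable).1 this
    obtain ⟨s, hs, hsδ, hsT⟩ := (c γ).exists_param_near_start (hci γ) hδ₁
      (by linarith) hT₁m (T := T₁) (by
        rw [hca]
        exact (measure_mono (inter_subset_inter_left _ (hctr γ))).trans_lt (not_le.1 h1)) hN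
    obtain ⟨t, ht, htδ, htT⟩ := (c γ).exists_param_near_end (hci γ) hδ₂
      (by linarith) hT₂m (T := T₂) (by
        rw [hcb]
        exact (measure_mono (inter_subset_inter_left _ (hctr γ))).trans_lt (not_le.1 h2)) hN
    have hus : |u ((c γ).arc s) - u x| ≤ ε :=
      not_lt.1 fun hlt => hsT (subset_toMeasurable _ _ hlt)
    have hut : |u ((c γ).arc t) - u y| ≤ ε :=
      not_lt.1 fun hlt => htT (subset_toMeasurable _ _ hlt)
    -- Here `s < δ₁ < d/2` and `t > ℓ - δ₂ > d/2`, because `ℓ ≥ d = dist x y`.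
    have h3 := hNu s hs t ht (by linarith)
    refine le_trans (ENNReal.ofReal_le_ofReal ?_) (h3.trans (liminf_le_liminf
      (Eventually.of_forall fun i => le_trans ?_ (hcint γ _ (hg i)))))
    · rw [abs_sub_comm (u ((c γ).arc t))]
      have e1 := abs_sub_le (u x) (u ((c γ).arc s)) (u y)
      have e2 := abs_sub_le (u ((c γ).arc s)) (u ((c γ).arc t)) (u y)
      rw [abs_sub_comm] at hus
      linarith
    · exact lintegral_mono_set (Icc_subset_Icc hs.1.1 ht.1.2)
  set v := ENNReal.ofReal (|u x - u y| - 2 * ε) with hv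
  -- The three bad families have total measure at most `3/8`. Chebyshev on the remaining half of the
  -- pencil produces the factor `2`.
  have hhalf : 2⁻¹ ≤ σ {γ | v ≤ Φ γ} := by
    have hcov : (univ : Set Γ) ⊆ {γ | v ≤ Φ γ} ∪ (B₀ ∪ (B₁ ∪ B₂)) := by
      intro γ _
      by_contra hcon
      simp only [mem_union, not_or] at hcon
      exact hcon.1 (hgood γ hcon.2.1 hcon.2.2.1 hcon.2.2.2)
    have h1 : 1 ≤ σ {γ | v ≤ Φ γ} + 2⁻¹ := by
      calc (1 : ℝ≥0∞) = σ univ := measure_univ.symm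
        _ ≤ _ := measure_mono hcov
        _ ≤ σ {γ | v ≤ Φ γ} + (σ B₀ + (σ B₁ + σ B₂)) :=
            (measure_union_le _ _).trans (add_le_add le_rfl ((measure_union_le _ _).trans
              (add_le_add le_rfl (measure_union_le _ _))))
        _ ≤ σ {γ | v ≤ Φ γ} + (ENNReal.ofReal (1 / 8) + (ENNReal.ofReal (1 / 8) +
              ENNReal.ofReal (1 / 8))) := by gcongr
        _ ≤ σ {γ | v ≤ Φ γ} + 2⁻¹ := by
            gcongr
            rw [← ENNReal.ofReal_add (by norm_num) (by norm_num),
              ← ENNReal.ofReal_add (by norm_num) (by norm_num)]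
            rw [show (2⁻¹ : ℝ≥0∞) = ENNReal.ofReal (1 / 2) by
              rw [one_div, ENNReal.ofReal_inv_of_pos (by norm_num)]; norm_num]
            exact ENNReal.ofReal_le_ofReal (by norm_num)
    rw [← ENNReal.inv_two_add_inv_two] at h1
    exact (ENNReal.add_le_add_iff_right (by simp)).1 h1
  have hfin := (mul_meas_ge_le_lintegral₀ hΦm v).trans hΦle
  have hv2 : v ≤ 2 * (ENNReal.ofReal C *
      liminf (fun i => ∫⁻ z in twoBalls C x y, g i z * rieszKernel μ x y z ∂μ) atTop) := by
    calc v = 2 * (v * 2⁻¹) := by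
          rw [mul_comm v, ← mul_assoc, ENNReal.mul_inv_cancel (by simp) (by simp), one_mul]
      _ ≤ 2 * (v * σ {γ | v ≤ Φ γ}) := by gcongr
      _ ≤ _ := by gcongr
  calc ENNReal.ofReal |u x - u y| = ENNReal.ofReal ((|u x - u y| - 2 * ε) + e) := by
        rw [hεdef]; ring_nf
    _ ≤ v + ENNReal.ofReal e := ENNReal.ofReal_add_le
    _ ≤ _ := by
        rw [ENNReal.ofReal_coe_nnreal]
        gcongr

end IsPencil

end

/-! ### Integration of the pointwise estimate over pairs of points in a ball. -/

noncomputable section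

variable {X : Type*} [MetricSpace X] [MeasurableSpace X] [BorelSpace X] {μ : Measure X} {D : ℝ≥0∞}

/-- The Riesz potential of `f` restricted to `S`. -/
def rieszPotential (μ : Measure X) (S : Set X) (f : X → ℝ≥0∞) (x : X) : ℝ≥0∞ :=
  ∫⁻ z in S, f z * rieszPole μ x z ∂μ

namespace DoublingWith

variable (h : DoublingWith μ D)
include h

theorem measurable_rieszPotential (S : Set X) {f : X → ℝ≥0∞} (hf : Measurable f) :
    Measurable (rieszPotential μ S f) := by
  have := h.sigmaFinite
  exact ((hf.comp measurable_snd).mul h.measurable_rieszPole).lintegral_prod_right'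

theorem lintegral_rieszKernel_le {S T : Set X} (hTS : T ⊆ S) {f : X → ℝ≥0∞}
    (hf : Measurable f) (x y : X) :
    ∫⁻ z in T, f z * rieszKernel μ x y z ∂μ ≤ rieszPotential μ S f x + rieszPotential μ S f y := by
  refine (lintegral_mono_set hTS).trans (le_of_eq ?_)
  simp only [rieszKernel_eq, mul_add]
  exact lintegral_add_left (hf.mul (h.measurable_rieszPole_right x)) _

/-- Both poles stay under a single liminf, since a liminf of sums is not bounded by the sum of
liminfs. Fatou is applied in `y` and then in `x`, and Tonelli for each fixed `i`. -/
theorem lintegral_lintegral_liminf_rieszPotential_le {B S : Set X} (x₀ : X) {R : ℝ} (hR : 0 < R)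
    (hB : B ⊆ ball x₀ R) (hS : S ⊆ ball x₀ R) (hSm : MeasurableSet S) {f : ℕ → X → ℝ≥0∞}
    (hf : ∀ i, Measurable (f i)) :
    ∫⁻ x in B, ∫⁻ y in B, liminf (fun i => rieszPotential μ S (f i) x + rieszPotential μ S (f i) y)
        atTop ∂μ ∂μ ≤
      2 * μ B * (D * (D * ENNReal.ofReal (4 * R))) *
        liminf (fun i => ∫⁻ z in S, f i z ∂μ) atTop := by
  have hm := fun i => h.measurable_rieszPotential S (hf i)
  have hBt : μ B ≠ ∞ := ne_top_of_le_ne_top (h.fin x₀ R) (measure_mono hB)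
  have hK : 2 * μ B * (D * (D * ENNReal.ofReal (4 * R))) ≠ ∞ := by
    have := h.ne_top
    finiteness
  have h1 : ∀ x, ∫⁻ y in B, liminf (fun i => rieszPotential μ S (f i) x +
      rieszPotential μ S (f i) y) atTop ∂μ ≤
      liminf (fun i => rieszPotential μ S (f i) x * μ B +
        ∫⁻ y in B, rieszPotential μ S (f i) y ∂μ) atTop := by
    intro x
    refine (lintegral_liminf_le fun i => (hm i).const_add _).trans (le_of_eq ?_)
    congr 1
    ext i
    rw [lintegral_add_left measurable_const, setLIntegral_const]
  refine (lintegral_mono h1).trans ?_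
  refine (lintegral_liminf_le fun i => ((hm i).mul_const _).add_const _).trans ?_
  rw [← ENNReal.liminf_const_mul_of_ne_top hK]
  refine liminf_le_liminf (Eventually.of_forall fun i => ?_)
  rw [lintegral_add_left ((hm i).mul_const _), lintegral_mul_const _ (hm i), setLIntegral_const]
  have h2 := h.lintegral_lintegral_rieszPole_le x₀ hR hB hS hSm (hf i)
  calc (∫⁻ x in B, rieszPotential μ S (f i) x ∂μ) * μ B +
        (∫⁻ x in B, rieszPotential μ S (f i) x ∂μ) * μ B
      = 2 * μ B * ∫⁻ x in B, rieszPotential μ S (f i) x ∂μ := by ring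
    _ ≤ 2 * μ B * (D * (D * ENNReal.ofReal (4 * R)) * ∫⁻ z in S, f i z ∂μ) := by
        gcongr; exact h2
    _ = _ := by ring

/-- Take admissible sequences with mass below `1/(k+1)`. The infimum over `k` of their potential
liminfs has zero double integral, so it vanishes for almost every pair, and a single `k` then serves
each `κ`. -/
theorem exists_admissible_of_AMModulus_eq_zero {Γ₀ : Set (RectCurve X)}
    (hΓ₀ : AMModulus μ Γ₀ = 0) {B S : Set X} (x₀ : X) {R : ℝ} (hR : 0 < R)
    (hB : B ⊆ ball x₀ R) (hS : S ⊆ ball x₀ R) (hSm : MeasurableSet S) :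
    ∀ᵐ x ∂μ.restrict B, ∀ᵐ y ∂μ.restrict B, ∀ κ : ℝ≥0∞, 0 < κ → ∃ ρ ∈ AMAdmissible Γ₀,
      liminf (fun i => rieszPotential μ S (ρ i) x + rieszPotential μ S (ρ i) y) atTop ≤ κ := by
  have := h.sigmaFinite
  have hBt : μ B ≠ ∞ := ne_top_of_le_ne_top (h.fin x₀ R) (measure_mono hB)
  have hpick : ∀ k : ℕ, ∃ ρ ∈ AMAdmissible Γ₀,
      liminf (fun i => ∫⁻ z, ρ i z ∂μ) atTop < ((k + 1 : ℕ) : ℝ≥0∞)⁻¹ := by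
    intro k
    have : AMModulus μ Γ₀ < ((k + 1 : ℕ) : ℝ≥0∞)⁻¹ := by
      rw [hΓ₀]; exact ENNReal.inv_pos.2 (ENNReal.natCast_ne_top _)
    obtain ⟨ρ, hρ⟩ := iInf_lt_iff.1 this
    obtain ⟨hρ1, hρ2⟩ := iInf_lt_iff.1 hρ
    exact ⟨ρ, hρ1, hρ2⟩
  choose ρ hρΓ hρk using hpick
  set H : ℕ → X × X → ℝ≥0∞ := fun k p => liminf (fun i => rieszPotential μ S (ρ k i) p.1 +
    rieszPotential μ S (ρ k i) p.2) atTop with hH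
  have hm := fun k i => h.measurable_rieszPotential S ((hρΓ k).1 i)
  have hHm : Measurable fun p => ⨅ k, H k p := Measurable.iInf fun k => Measurable.liminf fun i =>
    ((hm k i).comp measurable_fst).add ((hm k i).comp measurable_snd)
  have hzero : ∫⁻ x in B, ∫⁻ y in B, (⨅ k, H k (x, y)) ∂μ ∂μ = 0 := by
    set K := 2 * μ B * (D * (D * ENNReal.ofReal (4 * R))) with hK
    have hKt : K ≠ ∞ := by
      have := h.ne_top
      finiteness
    have hle : ∀ k : ℕ, ∫⁻ x in B, ∫⁻ y in B, (⨅ k, H k (x, y)) ∂μ ∂μ ≤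
        K * ((k + 1 : ℕ) : ℝ≥0∞)⁻¹ := by
      intro k
      refine (lintegral_mono fun x => lintegral_mono fun y => iInf_le _ k).trans
        ((h.lintegral_lintegral_liminf_rieszPotential_le x₀ hR hB hS hSm (hρΓ k).1).trans ?_)
      gcongr
      refine le_trans (liminf_le_liminf (Eventually.of_forall fun i => ?_)) (hρk k).le
      exact setLIntegral_le_lintegral _ _
    have ht := (ENNReal.Tendsto.const_mul (ENNReal.tendsto_inv_nat_nhds_zero.comp
      (tendsto_add_atTop_nat 1)) (Or.inr hKt)
      : Tendsto (fun k : ℕ => K * ((k + 1 : ℕ) : ℝ≥0∞)⁻¹) atTop _)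
    rw [mul_zero] at ht
    exact le_antisymm (ge_of_tendsto' ht hle) zero_le
  rw [lintegral_eq_zero_iff hHm.lintegral_prod_right'] at hzero
  filter_upwards [hzero] with x hx
  have hx' : ∫⁻ y in B, (⨅ k, H k (x, y)) ∂μ = 0 := hx
  have hHx : Measurable fun y => ⨅ k, H k (x, y) := hHm.comp measurable_prodMk_left
  rw [lintegral_eq_zero_iff hHx] at hx'
  filter_upwards [hx'] with y hy κ hκ
  have hy : (⨅ k, H k (x, y)) = 0 := hy
  obtain ⟨k, hk⟩ := iInf_lt_iff.1 (hy.trans_lt hκ)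
  exact ⟨ρ k, hρΓ k, hk.le⟩

theorem ae_ae_ofReal_abs_sub_le {C : ℝ} (hC : 0 < C)
    (hX : ∀ x y : X, x ≠ y →
      ∃ (Γ : Set (RectCurve X)) (_ : MeasurableSpace Γ) (σ : Measure Γ), IsPencil μ C x y σ)
    {u : X → ℝ} (hum : AEMeasurable u μ) {g : ℕ → X → ℝ≥0∞} (hg : IsBVAMUpperBound μ u g)
    (x₀ : X) {r : ℝ} (hr : 0 < r) :
    ∀ᵐ x ∂μ.restrict (ball x₀ r), ∀ᵐ y ∂μ.restrict (ball x₀ r),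
      ENNReal.ofReal |u x - u y| ≤ 2 * (ENNReal.ofReal C *
        liminf (fun i => rieszPotential μ (ball x₀ ((2 * C + 1) * r)) (g i) x +
          rieszPotential μ (ball x₀ ((2 * C + 1) * r)) (g i) y) atTop) := by
  obtain ⟨hgm, ⟨Γ₀, hΓ₀, hu⟩, -⟩ := hg
  set S := ball x₀ ((2 * C + 1) * r) with hS
  have hBS : ball x₀ r ⊆ S := ball_subset_ball (by nlinarith)
  have hlow : ∀ᵐ x ∂μ, Subsingleton X ∨ x ∈ finiteLowerDensitySet μ := by
    rcases subsingleton_or_nontrivial X with hs | hs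
    · exact Eventually.of_forall fun _ => Or.inl hs
    · have : ∀ᵐ x ∂μ, x ∈ finiteLowerDensitySet μ :=
        h.measure_compl_finiteLowerDensitySet hC hX
      filter_upwards [this] with x hx using Or.inr hx
  have hgood : ∀ᵐ x ∂μ.restrict (ball x₀ r), x ∈ ball x₀ r ∧
      (Subsingleton X ∨ x ∈ finiteLowerDensitySet μ) ∧ ApproxContinuousAt μ u x := by
    filter_upwards [ae_restrict_mem measurableSet_ball, ae_restrict_of_ae hlow,
      ae_restrict_of_ae (h.ae_approx_continuous hum)] with x h1 h2 h3 using ⟨h1, h2, h3⟩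
  filter_upwards [hgood, h.exists_admissible_of_AMModulus_eq_zero hΓ₀ x₀ (by positivity) hBS
    (Subset.refl S) measurableSet_ball] with x ⟨hxB, hxl, hxu⟩ hx
  filter_upwards [hgood, hx] with y ⟨hyB, hyl, hyu⟩ hxyκ
  rcases eq_or_ne x y with rfl | hxy
  · simp
  have hns : ¬ Subsingleton X := fun hs => hxy (Subsingleton.elim _ _)
  -- Replacing the pair-dependent region by the fixed ball `S` is what allows Tonelli; `d(x,y) ≤ 2r`
  -- gives the dilation `2C + 1`.
  have hT : twoBalls C x y ⊆ S := by
    have hd : dist x y ≤ 2 * r := by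
      rw [mem_ball] at hxB hyB
      linarith [dist_triangle_right x y x₀]
    have := twoBalls_subset_ball hC (le_of_lt hxB) (le_of_lt hyB) hd
    rwa [show C * (2 * r) + r = (2 * C + 1) * r by ring] at this
  obtain ⟨Γ, mΓ, σ, hσ⟩ := hX x y hxy
  refine (hσ.ofReal_abs_sub_le h hxy (hxl.resolve_left hns) (hyl.resolve_left hns) hxu hyu
    (fun i => (hgm i).1) hu ?_).trans ?_
  · intro κ hκ
    obtain ⟨ρ, hρ, hle⟩ := hxyκ κ hκ
    refine ⟨ρ, hρ, le_trans (liminf_le_liminf (Eventually.of_forall fun i => ?_)) hle⟩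
    exact h.lintegral_rieszKernel_le hT (hρ.1 i) x y
  · gcongr 2 * (ENNReal.ofReal C * ?_)
    exact liminf_le_liminf (Eventually.of_forall fun i =>
      h.lintegral_rieszKernel_le hT (hgm i).1 x y)

end DoublingWith

-- If `u` is not integrable on `B`, then neither is `u x - u` for any constant `u x`, so the inner
-- integral is infinite at every `x`.
omit [MetricSpace X] [BorelSpace X] in
theorem integrableOn_of_lintegral_lintegral_ne_top {B : Set X} (hB : μ B ≠ ∞) (hB0 : μ B ≠ 0)
    {u : X → ℝ} (hu : AEMeasurable u μ)
    (hfin : ∫⁻ x in B, ∫⁻ y in B, ENNReal.ofReal |u x - u y| ∂μ ∂μ ≠ ∞) : IntegrableOn u B μ := by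
  by_contra hcon
  refine hfin ?_
  have : IsFiniteMeasure (μ.restrict B) := ⟨by simpa using hB.lt_top⟩
  have key : ∀ x, ∫⁻ y in B, ENNReal.ofReal |u x - u y| ∂μ = ∞ := by
    intro x
    by_contra hx
    have hint : IntegrableOn (fun y => u x - u y) B μ := by
      refine ⟨(aemeasurable_const.sub hu).aestronglyMeasurable.restrict, ?_⟩
      rw [hasFiniteIntegral_iff_enorm]
      simp only [Real.enorm_eq_ofReal_abs]
      exact lt_top_iff_ne_top.2 hx
    have h2 : IntegrableOn (fun y => u x - (u x - u y)) B μ := (integrable_const (u x)).sub hint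
    simp only [sub_sub_cancel] at h2
    exact hcon h2
  simp only [key, setLIntegral_const]
  exact ENNReal.top_mul hB0

omit [MetricSpace X] [BorelSpace X] in
theorem ofReal_abs_sub_average_le {B : Set X} (hB : μ B ≠ ∞) (hB0 : μ B ≠ 0)
    {u : X → ℝ} (hu : IntegrableOn u B μ) (c : ℝ) :
    ENNReal.ofReal |c - ⨍ w in B, u w ∂μ| ≤
      (μ B)⁻¹ * ∫⁻ w in B, ENNReal.ofReal |c - u w| ∂μ := by
  have : IsFiniteMeasure (μ.restrict B) := ⟨by simpa using hB.lt_top⟩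
  have hr0 : μ.real B ≠ 0 := (ENNReal.toReal_pos hB0 hB).ne'
  have e : c - ⨍ w in B, u w ∂μ = (μ.real B)⁻¹ * ∫ w in B, (c - u w) ∂μ := by
    rw [integral_sub (integrable_const c) hu, setAverage_eq, setIntegral_const, smul_eq_mul,
      smul_eq_mul, mul_sub, inv_mul_cancel_left₀ hr0]
  rw [e, ← Real.enorm_eq_ofReal_abs, enorm_mul]
  have e2 : ‖(μ.real B)⁻¹‖ₑ = (μ B)⁻¹ := by
    rw [Real.enorm_eq_ofReal (by positivity), measureReal_def, ENNReal.ofReal_inv_of_pos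
      (ENNReal.toReal_pos hB0 hB), ENNReal.ofReal_toReal hB]
  rw [e2]
  gcongr
  refine (enorm_integral_le_lintegral_enorm _).trans (le_of_eq ?_)
  simp only [Real.enorm_eq_ofReal_abs]

end

theorem proposition3p6 {X : Type*} [MetricSpace X] [CompleteSpace X]
    [MeasurableSpace X] [BorelSpace X] (μ : Measure X) (hμ : IsDoublingMeasure μ)
    (hX : SupportsSemmesPencil μ) : SupportsAMPoincare μ := by
  obtain ⟨D, h⟩ := hμ.exists_doublingWith
  obtain ⟨C, hC, hpen⟩ := hX.exists_isPencil
  set lam : ℝ := 2 * C + 1 with hlam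
  have hlam0 : 0 < lam := by positivity
  -- The factor `D ^ m` bounds `μ(λB)/μ(B)` and is used to normalize the right-hand side by `μ(λB)`.
  obtain ⟨m, hm⟩ := pow_unbounded_of_one_lt lam (by norm_num : (1 : ℝ) < 2)
  set K : ℝ≥0∞ := 4 * ENNReal.ofReal C * (D * (D * ENNReal.ofReal (4 * lam))) * D ^ m with hK
  have hKt : K ≠ ∞ := by
    have := h.ne_top
    have h2 := ENNReal.pow_ne_top (n := m) this
    rw [hK]
    finiteness
  have hK0 : K ≠ 0 := by
    have := h.D_ne_zero
    have h1 : ENNReal.ofReal C ≠ 0 := by simpa using hC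
    have h2 : ENNReal.ofReal (4 * lam) ≠ 0 := by simpa using hlam0
    simp only [hK, ne_eq, mul_eq_zero, pow_eq_zero_iff', not_or]
    refine ⟨⟨⟨by norm_num, h1⟩, this, this, h2⟩, fun hh => this hh.1⟩
  refine ⟨K.toReal, lam, ENNReal.toReal_pos hK0 hKt, by linarith, fun u g hu hg x₀ r hr => ?_⟩
  have hpair := h.ae_ae_ofReal_abs_sub_le hC hpen hu hg x₀ hr
  obtain ⟨hgm, -, hglim⟩ := hg
  set B := ball x₀ r with hB
  set S := ball x₀ (lam * r) with hS
  have hBS : B ⊆ S := ball_subset_ball (by nlinarith)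
  have hB0 : μ B ≠ 0 := (h.pos x₀ r hr).ne'
  have hBt : μ B ≠ ∞ := h.fin _ _
  have hS0 : μ S ≠ 0 := (h.pos x₀ _ (by positivity)).ne'
  have hSt : μ S ≠ ∞ := h.fin _ _
  have hSB : μ S ≤ D ^ m * μ B :=
    (measure_mono (ball_subset_ball (by gcongr))).trans (h.measure_pow x₀ hr m)
  set G := liminf (fun i => ∫⁻ z in S, g i z ∂μ) atTop with hG
  have hGt : G ≠ ∞ := ne_top_of_le_ne_top hglim.ne
    (liminf_le_liminf (Eventually.of_forall fun i => setLIntegral_le_lintegral _ _))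
  have hdouble : ∫⁻ x in B, ∫⁻ y in B, ENNReal.ofReal |u x - u y| ∂μ ∂μ ≤
      4 * ENNReal.ofReal C * (D * (D * ENNReal.ofReal (4 * (lam * r)))) * μ B * G := by
    have hc : 2 * ENNReal.ofReal C ≠ ∞ := by finiteness
    calc ∫⁻ x in B, ∫⁻ y in B, ENNReal.ofReal |u x - u y| ∂μ ∂μ
        ≤ ∫⁻ x in B, ∫⁻ y in B, 2 * ENNReal.ofReal C * liminf (fun i =>
            rieszPotential μ S (g i) x + rieszPotential μ S (g i) y) atTop ∂μ ∂μ := by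
          refine lintegral_mono_ae ?_
          filter_upwards [hpair] with x hx
          refine lintegral_mono_ae ?_
          filter_upwards [hx] with y hy
          rwa [mul_assoc]
      _ = 2 * ENNReal.ofReal C * ∫⁻ x in B, ∫⁻ y in B, liminf (fun i =>
            rieszPotential μ S (g i) x + rieszPotential μ S (g i) y) atTop ∂μ ∂μ := by
          simp only [lintegral_const_mul' _ _ hc]
      _ ≤ 2 * ENNReal.ofReal C *
            (2 * μ B * (D * (D * ENNReal.ofReal (4 * (lam * r)))) * G) := by
          gcongr
          exact h.lintegral_lintegral_liminf_rieszPotential_le x₀ (by positivity) hBS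
            (Subset.refl S) measurableSet_ball fun i => (hgm i).1
      _ = _ := by ring
  have hint : IntegrableOn u B μ := by
    refine integrableOn_of_lintegral_lintegral_ne_top hBt hB0 hu
      (ne_top_of_le_ne_top ?_ hdouble)
    have := h.ne_top
    finiteness
  refine ⟨hint, ?_⟩
  have hrhs : liminf (fun i => ⨍⁻ z in S, g i z ∂μ) atTop = (μ S)⁻¹ * G := by
    simp only [setLAverage_eq, div_eq_mul_inv, mul_comm _ (μ S)⁻¹]
    exact ENNReal.liminf_const_mul_of_ne_top (ENNReal.inv_ne_top.2 hS0)
  have hinv : (μ B)⁻¹ ≤ D ^ m * (μ S)⁻¹ := by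
    rw [← div_eq_mul_inv, ENNReal.le_div_iff_mul_le (Or.inl hS0) (Or.inl hSt), mul_comm,
      ← div_eq_mul_inv]
    exact ENNReal.div_le_of_le_mul hSB
  rw [hrhs, setLAverage_eq, ENNReal.ofReal_mul ENNReal.toReal_nonneg, ENNReal.ofReal_toReal hKt,
    div_eq_mul_inv]
  calc (∫⁻ z in B, ENNReal.ofReal |u z - ⨍ w in B, u w ∂μ| ∂μ) * (μ B)⁻¹
      ≤ (∫⁻ z in B, (μ B)⁻¹ * ∫⁻ w in B, ENNReal.ofReal |u z - u w| ∂μ ∂μ) * (μ B)⁻¹ := by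
        gcongr with z
        exact ofReal_abs_sub_average_le hBt hB0 hint (u z)
    _ = (μ B)⁻¹ * (∫⁻ z in B, ∫⁻ w in B, ENNReal.ofReal |u z - u w| ∂μ ∂μ) * (μ B)⁻¹ := by
        rw [lintegral_const_mul' _ _ (ENNReal.inv_ne_top.2 hB0)]
    _ ≤ (μ B)⁻¹ * (4 * ENNReal.ofReal C * (D * (D * ENNReal.ofReal (4 * (lam * r)))) * μ B * G) *
          (μ B)⁻¹ := by gcongr
    _ = 4 * ENNReal.ofReal C * (D * (D * ENNReal.ofReal (4 * (lam * r)))) * G * (μ B)⁻¹ *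
          (μ B * (μ B)⁻¹) := by ring
    _ = 4 * ENNReal.ofReal C * (D * (D * ENNReal.ofReal (4 * (lam * r)))) * G * (μ B)⁻¹ := by
        rw [ENNReal.mul_inv_cancel hB0 hBt, mul_one]
    _ ≤ 4 * ENNReal.ofReal C * (D * (D * ENNReal.ofReal (4 * (lam * r)))) * G *
          (D ^ m * (μ S)⁻¹) := by gcongr
    _ = K * ENNReal.ofReal r * ((μ S)⁻¹ * G) := by
        rw [← mul_assoc 4 lam r, ENNReal.ofReal_mul (q := r) (by positivity), hK]
        ring
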